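/- Let $k$ be a field and let $b,e,\ell$ be integers with $b\ge 2$ and $2\le \ell\le e-1$. Let $b_n$ ($\ell+1\le n\le e-1$) be integers such that $\lceil b/2\rceil n+1\le b_n$ for $\ell+1\le n\le e-1$, $b_{\ell+1}\le b\ell+b-1$ (if $\ell+1\le e-1$), and $b_{n+1}\le b_n+\lceil b/2\rceil$ for $\ell+1\le n\le e-2$. Put $$r=\max\bigl(\{n \mid \ell+1\le n\le e-1,\ b_n>bn-n+1\}\cup\{\ell\}\bigr),\qquad H=\langle e,\ be+1,\ b_ne+n\ (\ell+1\le n\le e-1)\rangle .$$ Let $C=k[H]=k[u^h \mid h\in H]\subseteq k[u]$, let $\mathfrak n=(u^h \mid 0\ne h\in H)C$ be its graded maximal ideal, $A=C_{\mathfrak n}$, $\mathfrak m=\mathfrak nA$ and $Q=u^eA$. Write $\ell_A$ for length, $\mu_A$ for minimal number of generators, $\tau(A)=\ell_A((Q:\mathfrak m)/Q)$ for the Cohen-Macaulay type, and $$n_{\mathfrak m}=\min\{n\ge 0\mid \mathfrak m^{n+1}\subseteq Q\},\quad r_{\mathfrak m}=\min\{n\ge 0\mid \mathfrak m^{n+1}=Q\mathfrak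 m^n\},\quad \Lambda_{\mathfrak m}=\{n\ge 1\mid (Q\mathfrak m^{n-1}\cap \mathfrak m^{n+1})/Q\mathfrak m^n\ne 0\},$$ and $G(\mathfrak m)=\bigoplus_{n\ge 0}\mathfrak m^n/\mathfrak m^{n+1}$. Then: 1. $A$ is a Cohen-Macaulay local ring with $\dim A=1$; it is stretched with respect to $Q$, that is, $Q$ is a parameter ideal and a reduction of $\mathfrak m$, $Q\cap\mathfrak m^2=Q\mathfrak m$, and $\ell_A((\mathfrak m^2+Q)/(\mathfrak m^3+Q))=1$; moreover $\tau(A)=e-\ell$ and $\mu_A(\mathfrak m)=e-\ell+1$. 2. $n_{\mathfrak m}=\ell$ and $r_{\mathfrak m}=r$. 3. $\Lambda_{\mathfrak m}=\{bn-b_n+1 \mid \ell+1\le n\le r\}$. 4. For all integers $n\ge r-1$, $$\ell_A(A/\mathfrak m^{n+1})=e(n+1)-\Bigl(e-1+\binom{\ell}{2}+\sum_{i=\ell+1}^{r}(b_i-bi+i-1)\Bigr).$$ 5. $G(\mathfrak m)$ is Cohen-Macaulay if and only if $r=\ell$; when $\ell+1\le e-1$, this is equivalent to $b_{\ell+1}\le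 b\ell+b-\ell$. Consequently the reduction number can be arbitrarily larger than the index of nilpotency: for every field $k$ and all integers $\ell\ge 2$, $N\ge 0$ there are $b$, $e$, $b_n$ as above such that $n_{\mathfrak m}=\ell$ and $r_{\mathfrak m}=\ell+N$. -/

import Mathlib

open Polynomial

noncomputable section

namespace StretchedRing

/-! ### Local algebra -/

/-- A Noetherian local ring is Cohen-Macaulay if its maximal ideal contains a regular sequence
whose length is the Krull dimension. -/
def IsCohenMacaulayLocal (R : Type*) [CommRing R] : Prop :=
  ∃ _ : IsLocalRing R, IsNoetherianRing R ∧
    ∃ rs : List R, (∀ x ∈ rs, x ∈ IsLocalRing.maximalIdeal R) ∧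
      RingTheory.Sequence.IsRegular R rs ∧ (rs.length : WithBot ℕ∞) = ringKrullDim R

/-- A Noetherian ring is Cohen-Macaulay if its localizations at all maximal ideals are. -/
def IsCohenMacaulayRing (R : Type*) [CommRing R] : Prop :=
  IsNoetherianRing R ∧
    ∀ (P : Ideal R) [P.IsMaximal], IsCohenMacaulayLocal (Localization.AtPrime P)

/-- The associated graded ring `G(I) = ⨁ₙ Iⁿ / Iⁿ⁺¹`, as the quotient `R(I) / I R(I)` of the Rees
algebra `R(I) = A[It] = ⨁ₙ Iⁿ tⁿ`. -/
abbrev AssociatedGradedRing {A : Type*} [CommRing A] (I : Ideal A) : Type _ :=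
  reesAlgebra I ⧸ I.map (algebraMap A (reesAlgebra I))

section Ideals

variable {A : Type*} [CommRing A]

/-- The length of the `A`-module `M / N`, for ideals `N ≤ M`. -/
def quotLength (M N : Ideal A) : ℕ∞ := Module.length A (M ⧸ N.submoduleOf M)

/-- A parameter ideal of a local ring of dimension `d`: an ideal primary to the maximal ideal and
generated by `d` elements. -/
def IsParameterIdeal [IsLocalRing A] (Q : Ideal A) : Prop :=
  Q.radical = IsLocalRing.maximalIdeal A ∧
    ∃ s : Finset A, (s.card : WithBot ℕ∞) = ringKrullDim A ∧ Ideal.span (s : Set A) = Q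

/-- `Q` is a reduction of `I`. -/
def IsReduction (Q I : Ideal A) : Prop := Q ≤ I ∧ ∃ n : ℕ, I ^ (n + 1) = Q * I ^ n

/-- `I` is stretched with respect to `Q`. For `I` the maximal ideal this says that the local
ring `A` is stretched. -/
def IsStretched [IsLocalRing A] (Q I : Ideal A) : Prop :=
  IsParameterIdeal Q ∧ IsReduction Q I ∧ Q ⊓ I ^ 2 = Q * I ∧
    quotLength (I ^ 2 ⊔ Q) (I ^ 3 ⊔ Q) = 1

/-- `n` is the index of nilpotency `n_Q(I) = min {n ≥ 0 | Iⁿ⁺¹ ⊆ Q}`. -/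
def IsNilpotencyIndex (Q I : Ideal A) (n : ℕ) : Prop := IsLeast {n : ℕ | I ^ (n + 1) ≤ Q} n

/-- `n` is the reduction number `r_Q(I) = min {n ≥ 0 | Iⁿ⁺¹ = Q Iⁿ}`. -/
def IsReductionNumber (Q I : Ideal A) (n : ℕ) : Prop :=
  IsLeast {n : ℕ | I ^ (n + 1) = Q * I ^ n} n

/-- `Λ_Q(I) = {n ≥ 1 | (Q Iⁿ⁻¹ ∩ Iⁿ⁺¹) / Q Iⁿ ≠ 0}`. -/
def Lam (Q I : Ideal A) : Set ℕ :=
  {n : ℕ | 1 ≤ n ∧ Q * I ^ (n - 1) ⊓ I ^ (n + 1) ≠ Q * I ^ n}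

/-- The Cohen-Macaulay type `τ(A) = ℓ_A((Q : 𝔪) / Q)`, computed with a parameter ideal `Q`. -/
def cmType [IsLocalRing A] (Q : Ideal A) : ℕ∞ :=
  quotLength (Q.colon (IsLocalRing.maximalIdeal A : Set A)) Q

end Ideals

/-! ### Numerical semigroup rings -/

section SemigroupRing

variable (k : Type*) [Field k] (H : AddSubmonoid ℕ)

/-- The semigroup ring `k[H] = k[uʰ | h ∈ H] ⊆ k[u]`. -/
def semigroupRing : Subalgebra k k[X] := Algebra.adjoin k {f | ∃ h ∈ H, f = X ^ h}

/-- The element `uʰ` of `k[H]`. -/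
def mono (h : H) : semigroupRing k H :=
  ⟨X ^ (h : ℕ), Algebra.subset_adjoin ⟨h, h.2, rfl⟩⟩

/-- The graded maximal ideal of `k[H]`, generated by all `uʰ` with `0 ≠ h ∈ H`. -/
def gradedMaxIdeal : Ideal (semigroupRing k H) :=
  Ideal.span {f | ∃ h : H, h ≠ 0 ∧ f = mono k H h}

/-- Evaluation at `u = 0`. -/
def constHom : semigroupRing k H →ₐ[k] k := (aeval (0 : k)).comp (semigroupRing k H).val

lemma sub_const_mem (f : k[X]) (hf : f ∈ semigroupRing k H) :
    ∃ c : k, (⟨f, hf⟩ - algebraMap k (semigroupRing k H) c) ∈ gradedMaxIdeal k H := by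
  refine Algebra.adjoin_induction
    (p := fun f hf => ∃ c : k,
      ((⟨f, hf⟩ : semigroupRing k H) - algebraMap k (semigroupRing k H) c) ∈ gradedMaxIdeal k H)
    ?_ ?_ ?_ ?_ hf
  · rintro _ ⟨h, hh, rfl⟩
    by_cases h0 : h = 0
    · refine ⟨1, ?_⟩
      subst h0
      convert (gradedMaxIdeal k H).zero_mem
      ext1
      simp
    · refine ⟨0, ?_⟩
      rw [map_zero, sub_zero]
      exact Ideal.subset_span ⟨⟨h, hh⟩, fun h' => h0 (congrArg Subtype.val h'), rfl⟩
  · intro c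
    refine ⟨c, ?_⟩
    convert (gradedMaxIdeal k H).zero_mem
    exact sub_self _
  · rintro x y hx hy ⟨c, hc⟩ ⟨d, hd⟩
    refine ⟨c + d, ?_⟩
    convert (gradedMaxIdeal k H).add_mem hc hd using 1
    rw [map_add, ← add_sub_add_comm]
    rfl
  · rintro x y hx hy ⟨c, hc⟩ ⟨d, hd⟩
    refine ⟨c * d, ?_⟩
    convert (gradedMaxIdeal k H).add_mem
      ((gradedMaxIdeal k H).mul_mem_right ⟨y, hy⟩ hc)
      ((gradedMaxIdeal k H).mul_mem_left (algebraMap k (semigroupRing k H) c) hd) using 1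
    rw [map_mul]
    change (⟨x, hx⟩ : semigroupRing k H) * ⟨y, hy⟩ - _ = _
    ring

lemma gradedMaxIdeal_eq_ker : gradedMaxIdeal k H = RingHom.ker (constHom k H) := by
  have hle : gradedMaxIdeal k H ≤ RingHom.ker (constHom k H) := by
    rw [gradedMaxIdeal, Ideal.span_le]
    rintro _ ⟨h, h0, rfl⟩
    have h0' : (h : ℕ) ≠ 0 := fun h' => h0 (Subtype.ext h')
    simp [RingHom.mem_ker, constHom, mono, h0']
  refine le_antisymm hle ?_
  rintro ⟨f, hf⟩ hker
  obtain ⟨c, hc⟩ := sub_const_mem k H f hf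
  have h1 := hle hc
  rw [RingHom.mem_ker, map_sub, RingHom.mem_ker.1 hker, AlgHom.commutes] at h1
  have h2 : c = 0 := by simpa using h1
  simpa [h2] using hc

instance gradedMaxIdeal_isMaximal : (gradedMaxIdeal k H).IsMaximal := by
  rw [gradedMaxIdeal_eq_ker]
  exact RingHom.ker_isMaximal_of_surjective (constHom k H)
    fun c => ⟨algebraMap k _ c, (constHom k H).commutes c⟩

/-- The localization of `k[H]` at its graded maximal ideal. -/
def LocalSemigroupRing : Type _ := Localization.AtPrime (gradedMaxIdeal k H)

instance : CommRing (LocalSemigroupRing k H) :=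
  inferInstanceAs (CommRing (Localization.AtPrime (gradedMaxIdeal k H)))

instance : Algebra (semigroupRing k H) (LocalSemigroupRing k H) :=
  inferInstanceAs (Algebra (semigroupRing k H) (Localization.AtPrime (gradedMaxIdeal k H)))

instance : IsLocalization.AtPrime (LocalSemigroupRing k H) (gradedMaxIdeal k H) :=
  inferInstanceAs
    (IsLocalization.AtPrime (Localization.AtPrime (gradedMaxIdeal k H)) (gradedMaxIdeal k H))

instance : IsLocalRing (LocalSemigroupRing k H) :=
  IsLocalization.AtPrime.isLocalRing (LocalSemigroupRing k H) (gradedMaxIdeal k H)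

end SemigroupRing

/-! ### The family of semigroups -/

/-- The inequalities imposed on `b`, `e`, `ℓ` and on the `bₙ`, `ℓ + 1 ≤ n ≤ e - 1`, where `bₙ` is
`β n`. (The lower bounds make every `bₙ` positive, so natural numbers suffice.) -/
structure Admissible (b e l : ℕ) (β : ℕ → ℕ) : Prop where
  two_le_b : 2 ≤ b
  two_le_l : 2 ≤ l
  l_lt_e : l < e
  lower : ∀ n, l + 1 ≤ n → n < e → ⌈(b : ℚ) / 2⌉₊ * n + 1 ≤ β n
  first : l + 1 < e → β (l + 1) < b * l + b
  step : ∀ n, l + 1 ≤ n → n + 1 < e → β (n + 1) ≤ β n + ⌈(b : ℚ) / 2⌉₊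

/-- `H = ⟨e, b e + 1, bₙ e + n (ℓ + 1 ≤ n ≤ e - 1)⟩`. -/
def semigroupH (b e l : ℕ) (β : ℕ → ℕ) : AddSubmonoid ℕ :=
  AddSubmonoid.closure ({e, b * e + 1} ∪ {m | ∃ n, l + 1 ≤ n ∧ n < e ∧ m = β n * e + n})

/-- The local ring `A = k[H]_𝔫`. -/
abbrev RingA (k : Type*) [Field k] (b e l : ℕ) (β : ℕ → ℕ) : Type _ :=
  LocalSemigroupRing k (semigroupH b e l β)

/-- The ideal `Q = uᵉ A`. -/
def idealQ (k : Type*) [Field k] (b e l : ℕ) (β : ℕ → ℕ) : Ideal (RingA k b e l β) :=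
  Ideal.span {algebraMap (semigroupRing k (semigroupH b e l β)) (RingA k b e l β)
    (mono k (semigroupH b e l β) ⟨e, AddSubmonoid.subset_closure (Or.inl (Or.inl rfl))⟩)}

/-- The maximal ideal `𝔪` of `A`. -/
abbrev idealM (k : Type*) [Field k] (b e l : ℕ) (β : ℕ → ℕ) : Ideal (RingA k b e l β) :=
  IsLocalRing.maximalIdeal (RingA k b e l β)

/-- `r` is the maximum of `{n | ℓ + 1 ≤ n ≤ e - 1, bₙ > bn - n + 1} ∪ {ℓ}`. -/
def IsR (b e l : ℕ) (β : ℕ → ℕ) (r : ℕ) : Prop :=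
  IsGreatest ({n : ℕ | l + 1 ≤ n ∧ n < e ∧ (b : ℤ) * n - n + 1 < β n} ∪ {l}) r

end StretchedRing

end

noncomputable section

namespace StretchedRing

/-! All ideals involved are monomial. Expanding elements of `A` as power series shows that a
monomial ideal is determined by its set of exponents, an ideal of `H`. Products, intersections,
inclusions and colons thus become statements about sets of integers, and finite lengths become
counts of exponents (`mem_monIdeal_iff`, `quotLength_monIdeal`).

Write an exponent as q e + n with 0 ≤ n < e. It has two natural factorizations: n copies of b e + 1
and q - b n copies of e, possible when q ≥ b n, with n + q - b n generators; or, for n > ℓ, one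
generator b_n e + n and q - b_n copies of e, with 1 + q - b_n generators. The inequalities on the
b_n ensure that one of these is longest. For n > ℓ the first is longer exactly when b_n > b n - n +
1, that is, when n ≤ r. The resulting order function is `ordAt`. Adding a generator raises it by at
least one (`add_generator`), and from a longest factorization one generator can be split off
(`filt_succ`); so 𝔪ʲ is spanned by the monomials of order at least j (`maximalIdeal_pow`).

Multiplication by uᵉ raises the order by exactly one, except for ℓ < n ≤ r at q = b n - 1: there the
first factorization becomes available and the order jumps from b n - b_n to n. These r - ℓ jumps
account for Λ, for the reduction number and for the sum in the Hilbert function.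

Modulo nilpotents, G(𝔪) is generated over the residue field by the initial form T of uᵉ. Hence G(𝔪)
is Cohen-Macaulay if and only if T is a nonzerodivisor, that is, if and only if there is no jump. -/

/-- `S` is an ideal of the semigroup `H`. -/
structure IsSemigroupIdeal (H : AddSubmonoid ℕ) (S : Set ℕ) : Prop where
  mem : ∀ s ∈ S, s ∈ H
  add_mem : ∀ s ∈ S, ∀ t ∈ H, s + t ∈ S

/-! ### Power series expansion and monomial ideals of the local semigroup ring. -/

section General

variable (k : Type*) [Field k] (H : AddSubmonoid ℕ)

/-- Elements of `k[H]` as power series. -/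
def toSeries : semigroupRing k H →+* PowerSeries k :=
  (Polynomial.coeToPowerSeries.ringHom (R := k)).comp (semigroupRing k H).val.toRingHom

lemma coeff_toSeries (f : semigroupRing k H) (n : ℕ) :
    PowerSeries.coeff n (toSeries k H f) = (f : k[X]).coeff n := by
  simp [toSeries]

lemma constHom_eq_coeff (f : semigroupRing k H) : constHom k H f = (f : k[X]).coeff 0 := by
  simp [constHom, coeff_zero_eq_eval_zero]

lemma isUnit_toSeries (f : (gradedMaxIdeal k H).primeCompl) : IsUnit (toSeries k H f) := by
  rw [PowerSeries.isUnit_iff_constantCoeff, isUnit_iff_ne_zero,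
    ← PowerSeries.coeff_zero_eq_constantCoeff_apply, coeff_toSeries, ← constHom_eq_coeff]
  intro h
  exact f.2 ((gradedMaxIdeal_eq_ker k H).ge h)

/-- The expansion of an element of the local ring as a power series. -/
def expand : LocalSemigroupRing k H →+* PowerSeries k :=
  IsLocalization.lift (M := (gradedMaxIdeal k H).primeCompl) (isUnit_toSeries k H)

@[simp] lemma expand_algebraMap (f : semigroupRing k H) :
    expand k H (algebraMap _ _ f) = toSeries k H f :=
  IsLocalization.lift_eq _ _

/-- The monomial `uʰ` of the local ring. -/
def mon (h : H) : LocalSemigroupRing k H := algebraMap (semigroupRing k H) _ (mono k H h)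

lemma expand_mon (h : H) : expand k H (mon k H h) = PowerSeries.X ^ (h : ℕ) := by
  rw [mon, expand_algebraMap]
  simp [toSeries, mono]

lemma mono_add (g h : H) : mono k H (g + h) = mono k H g * mono k H h := by
  ext1
  simp [mono, pow_add]

lemma mon_add (g h : H) : mon k H (g + h) = mon k H g * mon k H h := by
  rw [mon, mono_add, map_mul]; rfl

lemma mon_zero : mon k H 0 = 1 := by
  have : mono k H 0 = 1 := by ext1; simp [mono]
  rw [mon, this, map_one]

lemma mon_nsmul (i : ℕ) (h : H) : mon k H (i • h) = mon k H h ^ i := by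
  induction i with
  | zero => simp [mon_zero]
  | succ i ih => rw [succ_nsmul, mon_add, ih, pow_succ]

lemma coeff_eq_zero_of_mem (f : k[X]) (hf : f ∈ semigroupRing k H) :
    ∀ n ∉ H, f.coeff n = 0 := by
  refine Algebra.adjoin_induction (p := fun f _ => ∀ n ∉ H, f.coeff n = 0) ?_ ?_ ?_ ?_ hf
  · rintro _ ⟨h, hh, rfl⟩ n hn
    rw [coeff_X_pow, if_neg]
    rintro rfl
    exact hn hh
  · intro c n hn
    rw [Polynomial.algebraMap_apply, Algebra.algebraMap_self_apply, coeff_C, if_neg]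
    rintro rfl
    exact hn H.zero_mem
  · intro x y _ _ hx hy n hn
    rw [coeff_add, hx n hn, hy n hn, add_zero]
  · intro x y _ _ hx hy n hn
    rw [coeff_mul]
    refine Finset.sum_eq_zero fun ij hij => ?_
    rw [Finset.HasAntidiagonal.mem_antidiagonal] at hij
    by_cases h1 : ij.1 ∈ H
    · by_cases h2 : ij.2 ∈ H
      · exact absurd (hij ▸ H.add_mem h1 h2) hn
      · rw [hy _ h2, mul_zero]
    · rw [hx _ h1, zero_mul]

lemma eq_sum_mono (f : semigroupRing k H) :
    f = ∑ n : (f : k[X]).support, algebraMap k _ ((f : k[X]).coeff n) *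
      mono k H ⟨n, by
        by_contra h
        exact (mem_support_iff.1 n.2) (coeff_eq_zero_of_mem k H f f.2 n h)⟩ := by
  ext1
  rw [AddSubmonoidClass.coe_finsetSum]
  conv_lhs => rw [(f : k[X]).as_sum_support_C_mul_X_pow, ← Finset.sum_coe_sort]
  rfl

/-- The ideal generated by the monomials with exponents in `S`. -/
def monIdeal (S : Set ℕ) : Ideal (LocalSemigroupRing k H) :=
  Ideal.span {x | ∃ h : H, (h : ℕ) ∈ S ∧ x = mon k H h}

variable {k H}

lemma coeff_mul_eq_zero {S : Set ℕ} (hS : ∀ s ∈ S, ∀ t ∈ H, s + t ∈ S) {f g : PowerSeries k}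
    (hf : ∀ n ∉ S, PowerSeries.coeff n f = 0) (hg : ∀ n ∉ H, PowerSeries.coeff n g = 0) :
    ∀ n ∉ S, PowerSeries.coeff n (f * g) = 0 := by
  intro n hn
  rw [PowerSeries.coeff_mul]
  refine Finset.sum_eq_zero fun ij hij => ?_
  rw [Finset.HasAntidiagonal.mem_antidiagonal] at hij
  by_cases h1 : ij.1 ∈ S
  · by_cases h2 : ij.2 ∈ H
    · exact absurd (hij ▸ hS _ h1 _ h2) hn
    · rw [hg _ h2, mul_zero]
  · rw [hf _ h1, zero_mul]

/-- Division by a unit series keeps the support in `S`: at the lowest exponent of `f` outside `S`,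
the only surviving term of `f * g` is the one with the constant term of `g`. -/
lemma coeff_eq_zero_of_mul {S : Set ℕ} (hS : ∀ s ∈ S, ∀ t ∈ H, s + t ∈ S) {f g : PowerSeries k}
    (hfg : ∀ n ∉ S, PowerSeries.coeff n (f * g) = 0) (hg : ∀ n ∉ H, PowerSeries.coeff n g = 0)
    (hg0 : PowerSeries.coeff 0 g ≠ 0) : ∀ n ∉ S, PowerSeries.coeff n f = 0 := by
  intro n
  induction n using Nat.strong_induction_on with
  | _ n ih =>
    intro hn
    have h := hfg n hn
    rw [PowerSeries.coeff_mul, Finset.sum_eq_single (n, 0)] at h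
    · exact (mul_eq_zero.1 h).resolve_right hg0
    · rintro ⟨i, j⟩ hij hne
      rw [Finset.HasAntidiagonal.mem_antidiagonal] at hij
      dsimp only at hij ⊢
      by_cases h2 : j ∈ H
      · by_cases h1 : i ∈ S
        · exact absurd (hij ▸ hS _ h1 _ h2) hn
        · rw [ih i _ h1, zero_mul]
          rcases Nat.eq_zero_or_pos j with rfl | hj
          · exact absurd (by rw [← hij]; simp) hne
          · omega
      · rw [hg _ h2, mul_zero]
    · intro h'
      exact absurd (Finset.HasAntidiagonal.mem_antidiagonal.2 (by simp)) h'

lemma exists_mul_eq (a : LocalSemigroupRing k H) :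
    ∃ f g : semigroupRing k H, g ∉ gradedMaxIdeal k H ∧
      a * algebraMap _ _ g = algebraMap _ _ f := by
  obtain ⟨⟨f, g⟩, h⟩ := IsLocalization.surj (gradedMaxIdeal k H).primeCompl a
  exact ⟨f, g, g.2, h⟩

lemma coeff_zero_ne {g : semigroupRing k H} (hg : g ∉ gradedMaxIdeal k H) :
    PowerSeries.coeff 0 (toSeries k H g) ≠ 0 := by
  rwa [coeff_toSeries, ← constHom_eq_coeff, ne_eq, ← RingHom.mem_ker, ← gradedMaxIdeal_eq_ker]

lemma coeff_toSeries_eq_zero (f : semigroupRing k H) :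
    ∀ n ∉ H, PowerSeries.coeff n (toSeries k H f) = 0 := by
  intro n hn
  rw [coeff_toSeries]
  exact coeff_eq_zero_of_mem k H f f.2 n hn

lemma coeff_expand_eq_zero (a : LocalSemigroupRing k H) :
    ∀ n ∉ H, PowerSeries.coeff n (expand k H a) = 0 := by
  obtain ⟨f, g, hg, h⟩ := exists_mul_eq a
  refine coeff_eq_zero_of_mul (H := H) (S := H) (fun s hs t ht => H.add_mem hs ht) ?_
    (coeff_toSeries_eq_zero g) (coeff_zero_ne hg)
  rw [← expand_algebraMap, ← map_mul, h, expand_algebraMap]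
  exact coeff_toSeries_eq_zero f

lemma mon_mem_monIdeal {S : Set ℕ} {h : H} (hh : (h : ℕ) ∈ S) : mon k H h ∈ monIdeal k H S :=
  Ideal.subset_span ⟨h, hh, rfl⟩

/-- For the converse, clear the denominator: `a * g = f` with `g` a unit of the local ring and `f` a
polynomial whose support is still in `S`, so that `f` is a finite combination of the generating
monomials. -/
lemma mem_monIdeal_iff {S : Set ℕ} (hS : IsSemigroupIdeal H S) (a : LocalSemigroupRing k H) :
    a ∈ monIdeal k H S ↔ ∀ n ∉ S, PowerSeries.coeff n (expand k H a) = 0 := by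
  constructor
  · intro ha
    refine Submodule.span_induction
      (p := fun a _ => ∀ n ∉ S, PowerSeries.coeff n (expand k H a) = 0) ?_ ?_ ?_ ?_ ha
    · rintro _ ⟨h, hh, rfl⟩ n hn
      rw [expand_mon, PowerSeries.coeff_X_pow, if_neg]
      rintro rfl
      exact hn hh
    · intro n _; simp
    · intro x y _ _ hx hy n hn
      rw [map_add, map_add, hx n hn, hy n hn, add_zero]
    · intro c x _ hx
      rw [smul_eq_mul, map_mul, mul_comm]
      exact coeff_mul_eq_zero hS.add_mem hx (coeff_expand_eq_zero c)
  · intro ha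
    obtain ⟨f, g, hg, h⟩ := exists_mul_eq a
    have hu : IsUnit (algebraMap (semigroupRing k H) (LocalSemigroupRing k H) g) :=
      IsLocalization.map_units (M := (gradedMaxIdeal k H).primeCompl) _ ⟨g, hg⟩
    rw [← Ideal.mul_unit_mem_iff_mem _ hu, h, eq_sum_mono k H f, map_sum]
    refine Ideal.sum_mem _ fun n _ => ?_
    rw [map_mul]
    refine Ideal.mul_mem_left _ _ (mon_mem_monIdeal ?_)
    by_contra hn
    have h1 := coeff_mul_eq_zero hS.add_mem ha
      (coeff_toSeries_eq_zero g) n hn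
    rw [← expand_algebraMap, ← map_mul, h, expand_algebraMap, coeff_toSeries] at h1
    exact mem_support_iff.1 n.2 h1

lemma mon_mem_monIdeal_iff {S : Set ℕ} (hS : IsSemigroupIdeal H S) (h : H) :
    mon k H h ∈ monIdeal k H S ↔ (h : ℕ) ∈ S := by
  refine ⟨fun hm => ?_, mon_mem_monIdeal⟩
  by_contra hn
  have := (mem_monIdeal_iff hS _).1 hm h hn
  rw [expand_mon, PowerSeries.coeff_X_pow, if_pos rfl] at this
  exact one_ne_zero this

lemma monIdeal_mono {S T : Set ℕ} (h : S ⊆ T) : monIdeal k H S ≤ monIdeal k H T :=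
  Ideal.span_mono fun _ ⟨g, hg, hx⟩ => ⟨g, h hg, hx⟩

lemma monIdeal_le_iff {S T : Set ℕ} (hS : IsSemigroupIdeal H S) (hT : IsSemigroupIdeal H T) :
    monIdeal k H S ≤ monIdeal k H T ↔ S ⊆ T := by
  refine ⟨fun h s hs => ?_, monIdeal_mono⟩
  have hsH := hS.mem s hs
  exact (mon_mem_monIdeal_iff hT ⟨s, hsH⟩).1 (h (mon_mem_monIdeal hs))

lemma monIdeal_inj {S T : Set ℕ} (hS : IsSemigroupIdeal H S) (hT : IsSemigroupIdeal H T) :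
    monIdeal k H S = monIdeal k H T ↔ S = T := by
  rw [le_antisymm_iff, monIdeal_le_iff hS hT, monIdeal_le_iff hT hS, Set.Subset.antisymm_iff]

lemma IsSemigroupIdeal.inter {S T : Set ℕ} (hS : IsSemigroupIdeal H S)
    (hT : IsSemigroupIdeal H T) : IsSemigroupIdeal H (S ∩ T) :=
  ⟨fun s hs => hS.mem s hs.1, fun s hs t ht => ⟨hS.add_mem s hs.1 t ht, hT.add_mem s hs.2 t ht⟩⟩

lemma IsSemigroupIdeal.union {S T : Set ℕ} (hS : IsSemigroupIdeal H S)
    (hT : IsSemigroupIdeal H T) : IsSemigroupIdeal H (S ∪ T) :=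
  ⟨fun s hs => hs.elim (hS.mem s) (hT.mem s),
    fun s hs t ht => hs.imp (hS.add_mem s · t ht) (hT.add_mem s · t ht)⟩

lemma monIdeal_inf {S T : Set ℕ} (hS : IsSemigroupIdeal H S) (hT : IsSemigroupIdeal H T) :
    monIdeal k H S ⊓ monIdeal k H T = monIdeal k H (S ∩ T) := by
  ext a
  rw [Ideal.mem_inf, mem_monIdeal_iff hS, mem_monIdeal_iff hT, mem_monIdeal_iff (hS.inter hT)]
  refine ⟨fun ⟨h1, h2⟩ n hn => ?_, fun h => ⟨fun n hn => h n fun h' => hn h'.1,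
    fun n hn => h n fun h' => hn h'.2⟩⟩
  by_cases hn' : n ∈ S
  · exact h2 n fun h' => hn ⟨hn', h'⟩
  · exact h1 n hn'

lemma monIdeal_sup (S T : Set ℕ) :
    monIdeal k H S ⊔ monIdeal k H T = monIdeal k H (S ∪ T) := by
  rw [monIdeal, monIdeal, ← Ideal.span_union, monIdeal]
  congr 1
  ext x
  constructor
  · rintro (⟨h, hh, rfl⟩ | ⟨h, hh, rfl⟩)
    · exact ⟨h, Or.inl hh, rfl⟩
    · exact ⟨h, Or.inr hh, rfl⟩
  · rintro ⟨h, hh | hh, rfl⟩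
    · exact Or.inl ⟨h, hh, rfl⟩
    · exact Or.inr ⟨h, hh, rfl⟩

open scoped Pointwise in
lemma monIdeal_mul {S T : Set ℕ} (hS : ∀ s ∈ S, s ∈ H) (hT : ∀ s ∈ T, s ∈ H) :
    monIdeal k H S * monIdeal k H T = monIdeal k H (S + T) := by
  rw [monIdeal, monIdeal, Ideal.span_mul_span', monIdeal]
  congr 1
  ext x
  rw [Set.mem_mul]
  constructor
  · rintro ⟨_, ⟨g, hg, rfl⟩, _, ⟨h, hh, rfl⟩, rfl⟩
    exact ⟨g + h, Set.add_mem_add hg hh, (mon_add k H g h).symm⟩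
  · rintro ⟨⟨_, hx⟩, ⟨g, hg, h, hh, rfl⟩, rfl⟩
    exact ⟨_, ⟨⟨g, hS g hg⟩, hg, rfl⟩, _, ⟨⟨h, hT h hh⟩, hh, rfl⟩,
      (mon_add k H ⟨g, hS g hg⟩ ⟨h, hT h hh⟩).symm⟩

lemma monIdeal_univ : monIdeal k H (H : Set ℕ) = ⊤ := by
  rw [Ideal.eq_top_iff_one, ← mon_zero k H]
  exact mon_mem_monIdeal H.zero_mem

lemma isSemigroupIdeal_self : IsSemigroupIdeal H (H : Set ℕ) :=
  ⟨fun _ h => h, fun _ hs _ ht => H.add_mem hs ht⟩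

lemma isSemigroupIdeal_pos : IsSemigroupIdeal H {n : ℕ | n ∈ H ∧ n ≠ 0} :=
  ⟨fun _ h => h.1, fun _ hs _ ht => ⟨H.add_mem hs.1 ht, by have := hs.2; omega⟩⟩

lemma maximalIdeal_eq_monIdeal : IsLocalRing.maximalIdeal (LocalSemigroupRing k H) =
    monIdeal k H {n : ℕ | n ∈ H ∧ n ≠ 0} := by
  rw [← IsLocalization.AtPrime.map_eq_maximalIdeal (gradedMaxIdeal k H), gradedMaxIdeal,
    Ideal.map_span, monIdeal]
  congr 1
  ext x
  constructor
  · rintro ⟨_, ⟨h, h0, rfl⟩, rfl⟩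
    exact ⟨h, ⟨h.2, fun h' => h0 (Subtype.ext h')⟩, rfl⟩
  · rintro ⟨h, ⟨_, h0⟩, rfl⟩
    exact ⟨_, ⟨h, fun h' => h0 (congrArg Subtype.val h'), rfl⟩, rfl⟩

/-- It suffices to multiply by monomials, and multiplication by `uˢ` only shifts coefficients. So
the colon of monomial ideals is again monomial. -/
lemma mem_colon_monIdeal_iff {S T : Set ℕ} (hT : IsSemigroupIdeal H T)
    (hS : ∀ s ∈ S, s ∈ H) (a : LocalSemigroupRing k H) :
    a ∈ (monIdeal k H T).colon (monIdeal k H S : Set (LocalSemigroupRing k H)) ↔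
      ∀ n, ∀ s ∈ S, n + s ∉ T → PowerSeries.coeff n (expand k H a) = 0 := by
  have key : ∀ s : H, a * mon k H s ∈ monIdeal k H T ↔
      ∀ n, n + (s : ℕ) ∉ T → PowerSeries.coeff n (expand k H a) = 0 := by
    intro s
    rw [mem_monIdeal_iff hT, map_mul, expand_mon]
    constructor
    · intro h n hn
      rw [← h _ hn, PowerSeries.coeff_mul_X_pow]
    · intro h n hn
      rw [PowerSeries.coeff_mul_X_pow']
      split_ifs with hle
      · exact h _ (by rwa [Nat.sub_add_cancel hle])
      · rfl
  rw [Submodule.mem_colon]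
  constructor
  · intro h n s hs hn
    exact (key ⟨s, hS s hs⟩).1 (h _ (mon_mem_monIdeal hs)) n hn
  · intro h x hx
    refine Submodule.span_induction (p := fun x _ => a • x ∈ monIdeal k H T) ?_ ?_ ?_ ?_ hx
    · rintro _ ⟨s, hs, rfl⟩
      exact (key s).2 fun n hn => h n s hs hn
    · simp
    · intro x y _ _ hx hy
      rw [smul_add]
      exact add_mem hx hy
    · intro c x _ hx
      rw [smul_comm]
      exact Ideal.mul_mem_left _ _ hx

instance : IsDomain (LocalSemigroupRing k H) :=
  inferInstanceAs (IsDomain (Localization.AtPrime (gradedMaxIdeal k H)))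

lemma mon_ne_zero (h : H) : mon k H h ≠ 0 := by
  intro h0
  have := expand_mon k H h
  rw [h0, map_zero] at this
  exact pow_ne_zero _ PowerSeries.X_ne_zero this.symm

lemma semigroupRing_eq_adjoin {G : Set ℕ} (hG : AddSubmonoid.closure G = H) :
    semigroupRing k H = Algebra.adjoin k ((fun n => (X : k[X]) ^ n) '' G) := by
  apply le_antisymm
  · refine Algebra.adjoin_le ?_
    rintro _ ⟨h, hh, rfl⟩
    rw [← hG] at hh
    induction hh using AddSubmonoid.closure_induction with
    | mem x hx => exact Algebra.subset_adjoin ⟨x, hx, rfl⟩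
    | zero => simp
    | add x y _ _ hx hy => rw [pow_add]; exact Subalgebra.mul_mem _ hx hy
  · refine Algebra.adjoin_mono ?_
    rintro _ ⟨g, hg, rfl⟩
    exact ⟨g, hG ▸ AddSubmonoid.subset_closure hg, rfl⟩

lemma isNoetherianRing_local {G : Set ℕ} (hG : AddSubmonoid.closure G = H) (hfin : G.Finite) :
    IsNoetherianRing (LocalSemigroupRing k H) := by
  have h1 : (semigroupRing k H).FG := by
    rw [semigroupRing_eq_adjoin hG]
    exact Subalgebra.fg_def.2 ⟨_, hfin.image _, rfl⟩
  have : Algebra.FiniteType k (semigroupRing k H) := Subalgebra.fg_iff_finiteType _ |>.1 h1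
  have : IsNoetherianRing (semigroupRing k H) := Algebra.FiniteType.isNoetherianRing k _
  exact IsLocalization.isNoetherianRing (gradedMaxIdeal k H).primeCompl _ this

end General

/-! ### Lengths of quotients of ideals. -/

section Length

variable {A : Type*} [CommRing A]

lemma quotLength_add {N K M : Ideal A} (h1 : N ≤ K) (h2 : K ≤ M) :
    quotLength M N = quotLength K N + quotLength M K := by
  let f : (K ⧸ N.submoduleOf K) →ₗ[A] (M ⧸ N.submoduleOf M) :=
    Submodule.mapQ _ _ (Submodule.inclusion h2) (fun x hx => hx)
  let g : (M ⧸ N.submoduleOf M) →ₗ[A] (M ⧸ K.submoduleOf M) :=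
    Submodule.mapQ _ _ LinearMap.id (fun x hx => h1 hx)
  refine Module.length_eq_add_of_exact f g ?_ ?_ ?_
  · rw [injective_iff_map_eq_zero]
    intro x hx
    obtain ⟨x, rfl⟩ := Submodule.Quotient.mk_surjective _ x
    replace hx := (Submodule.Quotient.mk_eq_zero (N.submoduleOf M)).1 hx
    rw [Submodule.Quotient.mk_eq_zero]
    exact hx
  · intro x
    obtain ⟨x, rfl⟩ := Submodule.Quotient.mk_surjective _ x
    exact ⟨Submodule.Quotient.mk x, rfl⟩
  · intro x
    obtain ⟨x, rfl⟩ := Submodule.Quotient.mk_surjective _ x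
    refine (Submodule.Quotient.mk_eq_zero (K.submoduleOf M)).trans ?_
    constructor
    · intro hx
      exact ⟨Submodule.Quotient.mk ⟨x, hx⟩, rfl⟩
    · rintro ⟨y, hy⟩
      obtain ⟨y, rfl⟩ := Submodule.Quotient.mk_surjective _ y
      replace hy := (Submodule.Quotient.eq (N.submoduleOf M)).1 hy
      have h3 : (y : A) - (x : A) ∈ K := h1 hy
      have h4 := K.sub_mem y.2 h3
      rw [sub_sub_cancel] at h4
      exact h4

lemma quotLength_self (N : Ideal A) : quotLength N N = 0 := by
  rw [quotLength, Module.length_eq_zero_iff, Submodule.Quotient.subsingleton_iff,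
    Submodule.submoduleOf_self]

lemma length_quotient_eq (N : Ideal A) : Module.length A (A ⧸ N) = quotLength ⊤ N := by
  have : Submodule.map (Submodule.topEquiv (R := A) (M := A) : _ →ₗ[A] A) (N.submoduleOf ⊤) = N := by
    ext x
    constructor
    · rintro ⟨y, hy, rfl⟩
      exact hy
    · intro hx
      exact ⟨⟨x, trivial⟩, hx, rfl⟩
  exact (Submodule.Quotient.equiv _ _ Submodule.topEquiv this).length_eq.symm

/-- The map `a ↦ a * x` induces an isomorphism of the residue field with `M / N`. -/
lemma quotLength_eq_one [IsLocalRing A] {N M : Ideal A} (x : A) (hxM : x ∈ M) (hxN : x ∉ N)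
    (hM : M ≤ N ⊔ Ideal.span {x}) (hx : ∀ a ∈ IsLocalRing.maximalIdeal A, a * x ∈ N) :
    quotLength M N = 1 := by
  let f : A →ₗ[A] (M ⧸ N.submoduleOf M) :=
    (N.submoduleOf M).mkQ ∘ₗ LinearMap.toSpanSingleton A M ⟨x, hxM⟩
  have hf : ∀ a, f a = 0 ↔ a * x ∈ N := by
    intro a
    simp only [f, LinearMap.comp_apply, Submodule.mkQ_apply, Submodule.Quotient.mk_eq_zero]
    rfl
  have hker : LinearMap.ker f = IsLocalRing.maximalIdeal A := by
    symm
    refine Ideal.IsMaximal.eq_of_le inferInstance ?_ fun a ha => (hf a).2 (hx a ha)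
    intro htop
    have : (1 : A) ∈ LinearMap.ker f := htop ▸ trivial
    rw [LinearMap.mem_ker, hf, one_mul] at this
    exact hxN this
  have hsurj : Function.Surjective f := by
    intro y
    obtain ⟨⟨y, hy⟩, rfl⟩ := Submodule.Quotient.mk_surjective _ y
    obtain ⟨n, hn, z, hz, rfl⟩ := Submodule.mem_sup.1 (hM hy)
    obtain ⟨a, rfl⟩ := Ideal.mem_span_singleton'.1 hz
    refine ⟨a, ?_⟩
    simp only [f, LinearMap.comp_apply, Submodule.mkQ_apply, Submodule.Quotient.eq]
    change a * x - (n + a * x) ∈ N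
    rw [sub_add_cancel_right]
    exact N.neg_mem hn
  rw [quotLength, Module.length_eq_one_iff, isSimpleModule_iff_quot_maximal]
  exact ⟨_, inferInstance,
    ⟨(f.quotKerEquivOfSurjective hsurj).symm.trans (Submodule.quotEquivOfEq _ _ hker)⟩⟩

/-- Nakayama: the embedding dimension becomes a length, which can be counted by monomials. -/
lemma quotLength_maximalIdeal_sq [IsLocalRing A] [IsNoetherianRing A] :
    ((IsLocalRing.maximalIdeal A).spanFinrank : ℕ∞) =
      quotLength (IsLocalRing.maximalIdeal A) (IsLocalRing.maximalIdeal A ^ 2) := by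
  rw [IsLocalRing.spanFinrank_maximalIdeal_eq_finrank_cotangentSpace,
    ← Module.length_eq_finrank, ← Module.length_eq_of_surjective (S := A)
      (R := IsLocalRing.ResidueField A) (IsLocalRing.residue_surjective)]
  refine (Submodule.quotEquivOfEq _ _ ?_).length_eq
  ext x
  change _ ↔ (x : A) ∈ IsLocalRing.maximalIdeal A ^ 2
  constructor
  · intro h
    have := Submodule.mem_map_of_mem (f := (IsLocalRing.maximalIdeal A).subtype) h
    rwa [Submodule.map_smul'', Submodule.map_top, Submodule.range_subtype, smul_eq_mul,
      ← pow_two] at this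
  · intro h
    have h' : (x : A) ∈ Submodule.map (IsLocalRing.maximalIdeal A).subtype
        (IsLocalRing.maximalIdeal A • (⊤ : Submodule A (IsLocalRing.maximalIdeal A))) := by
      rwa [Submodule.map_smul'', Submodule.map_top, Submodule.range_subtype, smul_eq_mul,
        ← pow_two]
    obtain ⟨y, hy, hyx⟩ := h'
    rwa [← Subtype.ext hyx]

end Length

/-! ### Lengths between monomial ideals as numbers of exponents. -/

section MonomialLength

variable {k : Type*} [Field k] {H : AddSubmonoid ℕ}

lemma quotLength_monIdeal (F : Finset ℕ) : ∀ {S T : Set ℕ}, IsSemigroupIdeal H S →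
    IsSemigroupIdeal H T → (∀ n, n ∈ S ↔ n ∈ T ∨ n ∈ F) → (∀ n ∈ F, n ∉ T) →
    quotLength (monIdeal k H S) (monIdeal k H T) = F.card := by
  induction F using Finset.induction_on_max with
  | empty =>
    intro S T hS hT h _
    have : S = T := by ext n; simp [h]
    rw [this, quotLength_self, Finset.card_empty, Nat.cast_zero]
  | insert a F hF ih =>
    intro S T hS hT h hd
    have haF : a ∉ F := fun h => lt_irrefl _ (hF a h)
    have haS : a ∈ S := (h a).2 (Or.inr (Finset.mem_insert_self _ _))
    have haT : a ∉ T := hd a (Finset.mem_insert_self _ _)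
    -- The largest exponent of `S` outside `T` is killed modulo `T` by the maximal ideal, so
    -- adjoining it to `T` costs length one.
    have hgt : ∀ t ∈ H, t ≠ 0 → a + t ∈ T := by
      intro t ht h0
      refine ((h _).1 (hS.add_mem a haS t ht)).resolve_right fun h' => ?_
      rcases Finset.mem_insert.1 h' with h' | h'
      · omega
      · have := hF _ h'; omega
    have hT' : IsSemigroupIdeal H (T ∪ {a}) := by
      refine ⟨?_, ?_⟩
      · rintro s (hs | rfl)
        · exact hT.mem s hs
        · exact hS.mem _ haS
      · rintro s (hs | rfl) t ht
        · exact Or.inl (hT.add_mem s hs t ht)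
        · by_cases h0 : t = 0
          · subst h0; exact Or.inr rfl
          · exact Or.inl (hgt t ht h0)
    have hTS : T ∪ {a} ⊆ S := by
      rintro s (hs | rfl)
      · exact (h s).2 (Or.inl hs)
      · exact haS
    rw [quotLength_add (monIdeal_mono Set.subset_union_left) (monIdeal_mono hTS),
      ih hS hT' ?_ ?_, quotLength_eq_one (mon k H ⟨a, hS.mem _ haS⟩),
      Finset.card_insert_of_notMem haF, Nat.cast_add, Nat.cast_one, add_comm]
    · exact mon_mem_monIdeal (Or.inr rfl)
    · rwa [mon_mem_monIdeal_iff hT]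
    · rw [← monIdeal_sup]
      refine sup_le_sup_left ?_ _
      rw [monIdeal, Ideal.span_le]
      rintro _ ⟨g, hg, rfl⟩
      have : g = ⟨a, hS.mem _ haS⟩ := Subtype.ext hg
      rw [this]
      exact Ideal.subset_span rfl
    · intro x hx
      rw [mem_monIdeal_iff hT, map_mul, expand_mon]
      intro n hn
      rw [maximalIdeal_eq_monIdeal, mem_monIdeal_iff isSemigroupIdeal_pos] at hx
      rw [PowerSeries.coeff_mul_X_pow']
      split_ifs with hle
      · refine hx _ fun h' => hn ?_
        have := hgt _ h'.1 h'.2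
        dsimp only at hle this
        rwa [Nat.add_sub_cancel' hle] at this
      · rfl
    · intro n
      rw [h, Finset.mem_insert]
      simp only [Set.mem_union, Set.mem_singleton_iff]
      tauto
    · rintro n hn (h' | rfl)
      · exact hd n (Finset.mem_insert_of_mem hn) h'
      · exact haF hn

end MonomialLength

/-! ### The order function of the semigroups -/

/-- The consequences of admissibility used in the arithmetic of the semigroup, where `c` is
`⌈b / 2⌉`. -/
structure Bounds (b c e l : ℕ) (β : ℕ → ℕ) (r : ℕ) : Prop where
  c_lt : c < b
  b_le : b ≤ 2 * c
  two_le_l : 2 ≤ l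
  l_le_r : l ≤ r
  r_lt : r < e
  lower : ∀ n, l < n → n < e → c * n + 1 ≤ β n
  upper : ∀ n, l < n → n < e → β n + 1 ≤ b * n
  step : ∀ m n, l < m → m + n < e → β (m + n) ≤ β m + c * n
  large : ∀ n, l < n → n ≤ r → b * n + 2 ≤ β n + n
  small : ∀ n, r < n → n < e → β n + n ≤ b * n + 1

lemma ceil_half_lt {b : ℕ} (hb : 2 ≤ b) : ⌈(b : ℚ) / 2⌉₊ < b := by
  have h : ⌈(b : ℚ) / 2⌉₊ ≤ b - 1 := by
    rw [Nat.ceil_le, Nat.cast_sub (by omega), Nat.cast_one]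
    have : (2 : ℚ) ≤ b := by exact_mod_cast hb
    linarith
  omega

lemma le_two_mul_ceil_half (b : ℕ) : b ≤ 2 * ⌈(b : ℚ) / 2⌉₊ := by
  have h := Nat.le_ceil ((b : ℚ) / 2)
  have : (b : ℚ) ≤ ((2 * ⌈(b : ℚ) / 2⌉₊ : ℕ) : ℚ) := by
    push_cast
    linarith
  exact_mod_cast this

/-- Iterating the one-step inequality gives `step`; with the bound on `β (l + 1)` and c < b it gives
`upper`. -/
lemma Admissible.bounds {b e l r : ℕ} {β : ℕ → ℕ} (h : Admissible b e l β)
    (hr : IsR b e l β r) : Bounds b ⌈(b : ℚ) / 2⌉₊ e l β r := by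
  have hc := ceil_half_lt h.two_le_b
  have hb := le_two_mul_ceil_half b
  have hlow := h.lower
  have hstep1 := h.step
  generalize ⌈(b : ℚ) / 2⌉₊ = c at *
  have hstep : ∀ m n, l < m → m + n < e → β (m + n) ≤ β m + c * n := by
    intro m n hm
    induction n with
    | zero => intro _; simp
    | succ n ih =>
      intro hn
      have h1 := ih (by omega)
      have h2 := hstep1 (m + n) (by omega) (by omega)
      rw [Nat.mul_succ, ← Nat.add_assoc]
      omega
  have hup : ∀ n, l < n → n < e → β n + 1 ≤ b * n := by
    intro n hn hne
    obtain ⟨i, rfl⟩ := Nat.exists_eq_add_of_le hn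
    have h1 := hstep (l + 1) i (by omega) (by omega)
    have h2 := h.first (by omega)
    have h3 : c * i ≤ b * i := Nat.mul_le_mul_right _ hc.le
    rw [Nat.succ_eq_add_one, Nat.mul_add, Nat.mul_add, Nat.mul_one]
    omega
  have hlr : l ≤ r := hr.2 (Or.inr rfl)
  have hre : r < e := by
    rcases hr.1 with h1 | h1
    · exact h1.2.1
    · rw [h1]; exact h.l_lt_e
  refine ⟨hc, hb, h.two_le_l, hlr, hre, fun n h1 h2 => hlow n h1 h2, hup, hstep, ?_, ?_⟩
  · have hrr : l < r → b * r + 2 ≤ β r + r := by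
      intro hlr'
      rcases hr.1 with h1 | h1
      · have := h1.2.2
        have h2 : (b : ℤ) * r = ((b * r : ℕ) : ℤ) := by push_cast; rfl
        omega
      · have h1' : r = l := h1
        omega
    -- From r down to n, β decreases by at most c per step, whereas b n - n decreases by b - 1 ≥ c.
    -- So the inequality at r is inherited by all smaller indices above ℓ.
    intro n hn hnr
    have := hrr (by omega)
    obtain ⟨i, rfl⟩ := Nat.exists_eq_add_of_le hnr
    have h1 := hstep n i hn hre
    have h3 : c * i + i ≤ b * i := by nlinarith
    rw [Nat.mul_add] at this
    omega
  · intro n hn hne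
    by_contra hcon
    have h2 : (b : ℤ) * n = ((b * n : ℕ) : ℤ) := by push_cast; rfl
    have : n ≤ r := hr.2 (Or.inl ⟨by omega, hne, by omega⟩)
    omega

/-- The Apéry set of `H` with respect to `e`: the least element of `H` congruent to `n` modulo
`e` is `apery b l β n * e + n`. -/
def apery (b l : ℕ) (β : ℕ → ℕ) (n : ℕ) : ℕ := if n ≤ l then b * n else β n

/-- The largest number of generators in a factorization of `q * e + n`. -/
def ordAt (b l : ℕ) (β : ℕ → ℕ) (r q n : ℕ) : ℤ :=
  -- The first value counts n copies of b e + 1 and q - b n of e, the second one generator b_n e + n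
  -- and q - b_n of e. Integer values are needed because off `H` these expressions can be negative.
  if n ≤ l ∨ (n ≤ r ∧ b * n ≤ q) then (n : ℤ) + q - ((b * n : ℕ) : ℤ) else 1 + (q : ℤ) - β n

namespace Bounds

variable {b c e l r : ℕ} {β : ℕ → ℕ} (hB : Bounds b c e l β r)

lemma mul_facts (hB : Bounds b c e l β r) (n : ℕ) : c * n + n ≤ b * n ∧ b * n ≤ 2 * (c * n) ∧ n ≤ c * n := by
  have h1 := hB.c_lt
  have h2 := hB.b_le
  refine ⟨by nlinarith, by nlinarith, ?_⟩
  have : 1 ≤ c := by omega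
  nlinarith

lemma ordAt_le (hB : Bounds b c e l β r) {q n : ℕ} (hn : n < e) : ordAt b l β r q n ≤ q := by
  have h1 := hB.mul_facts n
  unfold ordAt
  split_ifs with h2
  · omega
  · have := hB.lower n (by omega) hn
    omega

lemma ordAt_nonneg {q n : ℕ} (h : apery b l β n ≤ q) : 0 ≤ ordAt b l β r q n := by
  unfold ordAt apery at *
  split_ifs at * <;> omega

/-- Equality can fail only when the increase of q reaches b n with ℓ < n ≤ r, where the formula
changes branch; `large` makes this a jump upwards. -/
lemma ordAt_add_one (hB : Bounds b c e l β r) {q n : ℕ} :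
    ordAt b l β r q n + 1 ≤ ordAt b l β r (q + 1) n := by
  unfold ordAt
  split_ifs with h1 h2 h2
  · omega
  · omega
  · have := hB.large n (by omega) (by omega)
    omega
  · omega

/-- Effect of adding the generator b e + 1. The strict inequality for n ≥ ℓ says that the sum lies
in e + H, which decides the socle; it comes from c < b and `upper`. -/
lemma apery_add (hB : Bounds b c e l β r) {q n : ℕ} (hn : n + 1 < e) (h : apery b l β n ≤ q) :
    apery b l β (n + 1) ≤ q + b ∧ (l ≤ n → apery b l β (n + 1) + 1 ≤ q + b) ∧
      ordAt b l β r q n + 1 ≤ ordAt b l β r (q + b) (n + 1) := by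
  have h0 := hB.l_le_r
  have hc := hB.c_lt
  have h1 : b * (n + 1) = b * n + b := rfl
  have h4 := hB.mul_facts n
  have hu := hB.upper (n + 1)
  have hla := hB.large (n + 1)
  have hsm := hB.small (n + 1)
  have hst := hB.step n 1
  have hlow := hB.lower n
  unfold ordAt apery at *
  split_ifs at * <;> omega

lemma apery_add_wrap (hB : Bounds b c e l β r) {q n : ℕ} (hn : n + 1 = e) :
    ordAt b l β r q n + 1 ≤ ordAt b l β r (q + b + 1) 0 := by
  have := hB.ordAt_le (q := q) (n := n) (by omega)
  have hc := hB.c_lt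
  have h2 : ordAt b l β r (q + b + 1) 0 = q + b + 1 := by simp [ordAt]
  omega

/-- Effect of adding b_m e + m without carry. The growth bound on β against the lower bound c m + 1
≤ b_m shows that a product of such a generator with another factor is never a better representative
of its residue class. -/
lemma apery_add_gen (hB : Bounds b c e l β r) {q n m : ℕ} (hm : l < m) (hn : n + m < e) (h : apery b l β n ≤ q) :
    apery b l β (n + m) ≤ q + β m ∧ (0 < n → apery b l β (n + m) + 1 ≤ q + β m) ∧
      ordAt b l β r q n + 1 ≤ ordAt b l β r (q + β m) (n + m) := by
  have h0 := hB.l_le_r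
  have h1 : b * (n + m) = b * n + b * m := Nat.mul_add _ _ _
  have h4 := hB.mul_facts n
  have h5 := hB.mul_facts m
  have hla := hB.large (n + m)
  have hst := hB.step n m
  have hst' := hB.step m n
  rw [Nat.add_comm m n] at hst'
  have hlow := hB.lower n
  have hlow' := hB.lower m
  unfold ordAt apery at *
  split_ifs at * <;> omega

/-- With a carry, the residue p is at most n and at most m, so the two lower bounds add up to at
least 2 c p ≥ b p. This is where c ≥ b / 2 matters. -/
lemma apery_add_gen_wrap (hB : Bounds b c e l β r) {q n m p : ℕ} (hm : l < m) (hme : m < e) (hn : n < e)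
    (hp : n + m = e + p) (h : apery b l β n ≤ q) :
    apery b l β p + 1 ≤ q + β m + 1 ∧
      ordAt b l β r q n + 1 ≤ ordAt b l β r (q + β m + 1) p := by
  have h0 := hB.l_le_r
  have h4 := hB.mul_facts n
  have h5 := hB.mul_facts m
  have h6 := hB.mul_facts p
  obtain ⟨i, rfl⟩ := Nat.exists_eq_add_of_le (show p ≤ n by omega)
  obtain ⟨j, rfl⟩ := Nat.exists_eq_add_of_le (show p ≤ m by omega)
  have h7 := hB.mul_facts i
  have h8 := hB.mul_facts j
  have e1 : b * (p + i) = b * p + b * i := Nat.mul_add _ _ _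
  have e2 : b * (p + j) = b * p + b * j := Nat.mul_add _ _ _
  have e3 : c * (p + i) = c * p + c * i := Nat.mul_add _ _ _
  have e4 : c * (p + j) = c * p + c * j := Nat.mul_add _ _ _
  have hla := hB.large p
  have hup := hB.upper p
  have hlow := hB.lower (p + i)
  have hlow' := hB.lower (p + j)
  unfold ordAt apery at *
  split_ifs at * <;> omega

end Bounds

/-! ### The order filtration -/

/-- The elements of `H` that are sums of at least `j` generators. -/
def filt (b e l : ℕ) (β : ℕ → ℕ) (r j : ℕ) : Set ℕ :=
  {h | apery b l β (h % e) ≤ h / e ∧ (j : ℤ) ≤ ordAt b l β r (h / e) (h % e)}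

lemma mul_add_div_self {e n : ℕ} (q : ℕ) (hn : n < e) : (q * e + n) / e = q := by
  rw [Nat.add_comm, Nat.add_mul_div_right _ _ (by omega), Nat.div_eq_of_lt hn, Nat.zero_add]

lemma mul_add_mod_self {e n : ℕ} (q : ℕ) (hn : n < e) : (q * e + n) % e = n := by
  rw [Nat.add_comm, Nat.add_mul_mod_self_right, Nat.mod_eq_of_lt hn]

lemma exists_eq_mul_add {e : ℕ} (he : 0 < e) (h : ℕ) : ∃ q n, n < e ∧ h = q * e + n :=
  ⟨h / e, h % e, Nat.mod_lt _ he, (Nat.div_add_mod' h e).symm⟩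

lemma ordAt_zero_right (b l : ℕ) (β : ℕ → ℕ) (r q : ℕ) : ordAt b l β r q 0 = q := by
  simp [ordAt]

lemma apery_zero (b l : ℕ) (β : ℕ → ℕ) : apery b l β 0 = 0 := by
  simp [apery]

lemma mem_filt {b e l r j q n : ℕ} {β : ℕ → ℕ} (hn : n < e) :
    q * e + n ∈ filt b e l β r j ↔ apery b l β n ≤ q ∧ (j : ℤ) ≤ ordAt b l β r q n := by
  rw [filt, Set.mem_ofPred_eq, mul_add_div_self q hn, mul_add_mod_self q hn]

lemma mem_image_add_filt {b e l r j q n : ℕ} {β : ℕ → ℕ} (hn : n < e) :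
    q * e + n ∈ (e + ·) '' filt b e l β r j ↔
      apery b l β n + 1 ≤ q ∧ (j : ℤ) ≤ ordAt b l β r (q - 1) n := by
  constructor
  · rintro ⟨h, hh, heq⟩
    obtain ⟨q', n', hn', rfl⟩ := exists_eq_mul_add (show 0 < e by omega) h
    have heq' : (q' + 1) * e + n' = q * e + n := by rw [← heq]; simp only; ring
    have h1 := congrArg (· / e) heq'
    have h2 := congrArg (· % e) heq'
    simp only [mul_add_div_self _ hn, mul_add_div_self _ hn', mul_add_mod_self _ hn,
      mul_add_mod_self _ hn'] at h1 h2
    subst h1 h2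
    rw [mem_filt hn] at hh
    exact ⟨by omega, hh.2⟩
  · rintro ⟨h1, h2⟩
    obtain ⟨q, rfl⟩ := Nat.exists_eq_add_of_lt (show 0 < q by omega)
    refine ⟨q * e + n, (mem_filt hn).2 ⟨by omega, ?_⟩, by simp only; ring⟩
    simpa using h2

lemma IsSemigroupIdeal.image_add {H : AddSubmonoid ℕ} {S : Set ℕ} (hS : IsSemigroupIdeal H S)
    {e : ℕ} (he : e ∈ H) : IsSemigroupIdeal H ((e + ·) '' S) := by
  refine ⟨?_, ?_⟩
  · rintro _ ⟨s, hs, rfl⟩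
    exact H.add_mem he (hS.mem s hs)
  · rintro _ ⟨s, hs, rfl⟩ t ht
    exact ⟨s + t, hS.add_mem s hs t ht, (Nat.add_assoc _ _ _).symm⟩

namespace Bounds

variable {b c e l r : ℕ} {β : ℕ → ℕ}

lemma add_generator (hB : Bounds b c e l β r) {g h : ℕ}
    (hg : g ∈ ({e, b * e + 1} ∪ {m | ∃ n, l + 1 ≤ n ∧ n < e ∧ m = β n * e + n} : Set ℕ))
    (hh : apery b l β (h % e) ≤ h / e) :
    apery b l β ((h + g) % e) ≤ (h + g) / e ∧
      ordAt b l β r (h / e) (h % e) + 1 ≤ ordAt b l β r ((h + g) / e) ((h + g) % e) := by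
  have he : 0 < e := by have := hB.r_lt; omega
  have h2 := hB.two_le_l
  have h3 := hB.l_le_r
  have h4 := hB.r_lt
  obtain ⟨q, n, hn, rfl⟩ := exists_eq_mul_add he h
  rw [mul_add_div_self q hn, mul_add_mod_self q hn] at *
  have key : ∀ q' n', n' < e → q * e + n + g = q' * e + n' → apery b l β n' ≤ q' →
      ordAt b l β r q n + 1 ≤ ordAt b l β r q' n' →
      apery b l β ((q * e + n + g) % e) ≤ (q * e + n + g) / e ∧
      ordAt b l β r q n + 1 ≤
        ordAt b l β r ((q * e + n + g) / e) ((q * e + n + g) % e) := by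
    intro q' n' hn' heq h1 h2
    rw [heq, mul_add_div_self q' hn', mul_add_mod_self q' hn']
    exact ⟨h1, h2⟩
  rcases hg with (rfl | rfl) | ⟨m, hm, hme, rfl⟩
  · exact key (q + 1) n hn (by ring) (by omega) hB.ordAt_add_one
  · by_cases hne : n + 1 < e
    · have := hB.apery_add hne hh
      exact key (q + b) (n + 1) hne (by ring) this.1 this.2.2
    · have hne' : n + 1 = e := by omega
      refine key (q + b + 1) 0 he ?_ (by rw [apery_zero]; omega) (hB.apery_add_wrap hne')
      calc q * e + n + (b * e + 1) = (q + b) * e + (n + 1) := by ring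
        _ = (q + b + 1) * e + 0 := by rw [hne']; ring
  · by_cases hne : n + m < e
    · have := hB.apery_add_gen (by omega) hne hh
      exact key (q + β m) (n + m) hne (by ring) this.1 this.2.2
    · obtain ⟨p, hp⟩ := Nat.exists_eq_add_of_le (show e ≤ n + m by omega)
      have := hB.apery_add_gen_wrap (by omega) hme hn hp hh
      refine key (q + β m + 1) p (by omega) ?_ (by omega) this.2
      calc q * e + n + (β m * e + m) = (q + β m) * e + (n + m) := by ring
        _ = (q + β m + 1) * e + p := by rw [hp]; ring

/-- Stated for translates of an arbitrary `h` so that closure induction on `t` applies; `h = 0` then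
gives the description of `H` and the positivity of the order. -/
lemma add_mem_aux (hB : Bounds b c e l β r) {t : ℕ} (ht : t ∈ semigroupH b e l β) :
    ∀ h, apery b l β (h % e) ≤ h / e → apery b l β ((h + t) % e) ≤ (h + t) / e ∧
      (t = 0 ∨ ordAt b l β r (h / e) (h % e) + 1 ≤
        ordAt b l β r ((h + t) / e) ((h + t) % e)) := by
  induction ht using AddSubmonoid.closure_induction with
  | mem g hg =>
    intro h hh
    exact ⟨(hB.add_generator hg hh).1, Or.inr (hB.add_generator hg hh).2⟩
  | zero =>
    intro h hh
    exact ⟨hh, Or.inl rfl⟩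
  | add x y _ _ hx hy =>
    intro h hh
    have h1 := hx h hh
    have h2 := hy _ h1.1
    rw [← Nat.add_assoc]
    refine ⟨h2.1, ?_⟩
    rcases h1.2 with rfl | h1'
    · rcases h2.2 with rfl | h2'
      · exact Or.inl rfl
      · exact Or.inr h2'
    · rcases h2.2 with rfl | h2'
      · exact Or.inr h1'
      · exact Or.inr (by omega)

lemma mem_semigroupH_iff (hB : Bounds b c e l β r) {q n : ℕ} (hn : n < e) :
    q * e + n ∈ semigroupH b e l β ↔ apery b l β n ≤ q := by
  constructor
  · intro h
    have := (hB.add_mem_aux h 0 (by simp [apery])).1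
    rwa [Nat.zero_add, mul_add_div_self q hn, mul_add_mod_self q hn] at this
  · intro h
    have he : e ∈ semigroupH b e l β := AddSubmonoid.subset_closure (Or.inl (Or.inl rfl))
    obtain ⟨t, rfl⟩ := Nat.exists_eq_add_of_le h
    have : (apery b l β n + t) * e + n = (apery b l β n * e + n) + t • e := by
      rw [smul_eq_mul]; ring
    rw [this]
    refine add_mem ?_ (nsmul_mem he t)
    unfold apery
    split_ifs with hnl
    · have h1 : b * e + 1 ∈ semigroupH b e l β :=
        AddSubmonoid.subset_closure (Or.inl (Or.inr rfl))
      have h2 := nsmul_mem h1 n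
      rw [smul_eq_mul] at h2
      convert h2 using 1
      ring
    · exact AddSubmonoid.subset_closure (Or.inr ⟨n, by omega, hn, rfl⟩)

lemma e_pos (hB : Bounds b c e l β r) : 0 < e := by have := hB.r_lt; omega

lemma mem_semigroupH_iff' (hB : Bounds b c e l β r) {h : ℕ} :
    h ∈ semigroupH b e l β ↔ apery b l β (h % e) ≤ h / e := by
  rw [← hB.mem_semigroupH_iff (Nat.mod_lt h hB.e_pos), Nat.div_add_mod']

lemma filt_zero (hB : Bounds b c e l β r) : filt b e l β r 0 = semigroupH b e l β := by
  ext h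
  rw [SetLike.mem_coe, hB.mem_semigroupH_iff']
  exact ⟨fun h' => h'.1, fun h' => ⟨h', by exact_mod_cast ordAt_nonneg h'⟩⟩

lemma ordAt_pos (hB : Bounds b c e l β r) {h : ℕ} (hh : h ∈ semigroupH b e l β) (h0 : h ≠ 0) :
    1 ≤ ordAt b l β r (h / e) (h % e) := by
  have := (hB.add_mem_aux hh 0 (by simp [apery])).2.resolve_left h0
  rw [Nat.zero_add, Nat.zero_div, Nat.zero_mod, ordAt_zero_right] at this
  simpa using this

lemma filt_one (hB : Bounds b c e l β r) :
    filt b e l β r 1 = {n | n ∈ semigroupH b e l β ∧ n ≠ 0} := by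
  ext h
  rw [Set.mem_ofPred_eq, hB.mem_semigroupH_iff']
  constructor
  · rintro ⟨h1, h2⟩
    refine ⟨h1, ?_⟩
    rintro rfl
    rw [Nat.zero_div, Nat.zero_mod, ordAt_zero_right] at h2
    norm_num at h2
  · rintro ⟨h1, h2⟩
    exact ⟨h1, hB.ordAt_pos (hB.mem_semigroupH_iff'.2 h1) h2⟩

lemma isSemigroupIdeal_filt (hB : Bounds b c e l β r) (j : ℕ) :
    IsSemigroupIdeal (semigroupH b e l β) (filt b e l β r j) := by
  refine ⟨fun s hs => hB.mem_semigroupH_iff'.2 hs.1, fun s hs t ht => ?_⟩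
  have := hB.add_mem_aux ht s hs.1
  refine ⟨this.1, ?_⟩
  rcases this.2 with rfl | h
  · exact hs.2
  · have := hs.2
    omega

lemma filt_anti {i j : ℕ} (h : i ≤ j) : filt b e l β r j ⊆ filt b e l β r i :=
  fun _ hs => ⟨hs.1, by have := hs.2; omega⟩

open scoped Pointwise in
-- One inclusion is that nonzero elements of `H` raise the order. For the other, a generator is
-- removed from a longest factorization.
lemma filt_succ (hB : Bounds b c e l β r) (j : ℕ) :
    filt b e l β r (j + 1) = filt b e l β r j + {n | n ∈ semigroupH b e l β ∧ n ≠ 0} := by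
  ext h
  rw [Set.mem_add]
  constructor
  · intro hh
    have hlr := hB.l_le_r
    have hl2 := hB.two_le_l
    have hre := hB.r_lt
    obtain ⟨q, n, hn, rfl⟩ := exists_eq_mul_add hB.e_pos h
    obtain ⟨h1, h2⟩ := (mem_filt hn).1 hh
    push_cast at h2
    -- Removing a copy of e.
    have sub_e : 1 ≤ q → apery b l β n ≤ q - 1 → (j : ℤ) ≤ ordAt b l β r (q - 1) n →
        ∃ x ∈ filt b e l β r j, ∃ y ∈ {n | n ∈ semigroupH b e l β ∧ n ≠ 0},
          x + y = q * e + n := by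
      intro hq h3 h4
      refine ⟨(q - 1) * e + n, (mem_filt hn).2 ⟨h3, h4⟩, e,
        ⟨AddSubmonoid.subset_closure (Or.inl (Or.inl rfl)), by omega⟩, ?_⟩
      obtain ⟨q, rfl⟩ := Nat.exists_eq_add_of_lt (show 0 < q by omega)
      simp only [Nat.zero_add, Nat.add_sub_cancel]
      ring
    -- Removing a copy of b e + 1, needed when no e is left, that is, when q = b n.
    have sub_u : 1 ≤ n → b ≤ q → apery b l β (n - 1) ≤ q - b →
        (j : ℤ) ≤ ordAt b l β r (q - b) (n - 1) →
        ∃ x ∈ filt b e l β r j, ∃ y ∈ {n | n ∈ semigroupH b e l β ∧ n ≠ 0},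
          x + y = q * e + n := by
      intro hn1 hq h3 h4
      refine ⟨(q - b) * e + (n - 1), (mem_filt (by omega)).2 ⟨h3, h4⟩, b * e + 1,
        ⟨AddSubmonoid.subset_closure (Or.inl (Or.inr rfl)), by omega⟩, ?_⟩
      obtain ⟨q, rfl⟩ := Nat.exists_eq_add_of_le hq
      obtain ⟨n, rfl⟩ := Nat.exists_eq_add_of_le hn1
      simp only [Nat.add_sub_cancel_left]
      ring
    by_cases hcase : n ≤ l ∨ (n ≤ r ∧ b * n ≤ q)
    · have hbn : b * n ≤ q := by
        rcases hcase with h3 | h3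
        · rwa [apery, if_pos h3] at h1
        · exact h3.2
      rw [ordAt, if_pos hcase] at h2
      rcases hbn.lt_or_eq with hlt | heq
      · refine sub_e (by omega) ?_ ?_
        · unfold apery
          split_ifs with h3
          · omega
          · have := hB.upper n (by omega) hn
            omega
        · rw [ordAt, if_pos (by omega)]
          omega
      · have hn1 : 1 ≤ n := by omega
        have h5 : b * n = b * (n - 1) + b := by
          obtain ⟨n, rfl⟩ := Nat.exists_eq_add_of_le hn1
          simp only [Nat.add_sub_cancel_left]
          ring
        refine sub_u hn1 (by omega) ?_ ?_
        · unfold apery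
          split_ifs with h3
          · omega
          · have := hB.upper (n - 1) (by omega) (by omega)
            omega
        · rw [ordAt, if_pos (by omega)]
          omega
    · have hap : apery b l β n = β n := by rw [apery, if_neg (by omega)]
      rw [ordAt, if_neg hcase] at h2
      rcases h1.lt_or_eq with hlt | heq
      · refine sub_e (by omega) (by omega) ?_
        rw [ordAt, if_neg (by omega)]
        omega
      -- Here q = b_n, so the element is itself a generator of order one and `j = 0`.
      · refine ⟨0, ?_, q * e + n, ⟨hB.mem_semigroupH_iff hn |>.2 h1, by omega⟩, Nat.zero_add _⟩
        have : j = 0 := by omega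
        subst this
        rw [hB.filt_zero]
        exact zero_mem _
  · rintro ⟨x, hx, y, ⟨hy, hy0⟩, rfl⟩
    have := hB.add_mem_aux hy x hx.1
    have h3 := this.2.resolve_left hy0
    have h4 := hx.2
    exact ⟨this.1, by push_cast; omega⟩

variable {k : Type*} [Field k]

lemma maximalIdeal_pow (hB : Bounds b c e l β r) (j : ℕ) :
    idealM k b e l β ^ j = monIdeal k (semigroupH b e l β) (filt b e l β r j) := by
  induction j with
  | zero => rw [pow_zero, hB.filt_zero, monIdeal_univ, Ideal.one_eq_top]
  | succ j ih =>
    rw [pow_succ, ih, idealM, maximalIdeal_eq_monIdeal,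
      monIdeal_mul (hB.isSemigroupIdeal_filt j).mem (fun s hs => hs.1), ← hB.filt_succ]

lemma idealM_eq (hB : Bounds b c e l β r) :
    idealM k b e l β = monIdeal k (semigroupH b e l β) (filt b e l β r 1) := by
  rw [← hB.maximalIdeal_pow, pow_one]

end Bounds

/-- The exponent `e` as an element of `H`. -/
def expE (b e l : ℕ) (β : ℕ → ℕ) : semigroupH b e l β :=
  ⟨e, AddSubmonoid.subset_closure (Or.inl (Or.inl rfl))⟩

lemma idealQ_eq_span (k : Type*) [Field k] (b e l : ℕ) (β : ℕ → ℕ) :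
    idealQ k b e l β = Ideal.span {mon k (semigroupH b e l β) (expE b e l β)} := rfl

lemma idealQ_mul_monIdeal {k : Type*} [Field k] {b e l : ℕ} {β : ℕ → ℕ} {S : Set ℕ}
    (hS : IsSemigroupIdeal (semigroupH b e l β) S) :
    idealQ k b e l β * monIdeal k (semigroupH b e l β) S =
      monIdeal k (semigroupH b e l β) ((e + ·) '' S) := by
  rw [idealQ_eq_span, monIdeal, Ideal.span_mul_span', monIdeal, Set.singleton_mul]
  congr 1
  ext x
  constructor
  · rintro ⟨_, ⟨h, hh, rfl⟩, rfl⟩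
    exact ⟨expE b e l β + h, ⟨h, hh, rfl⟩, (mon_add k _ _ h).symm⟩
  · rintro ⟨⟨_, _⟩, ⟨h, hh, rfl⟩, rfl⟩
    exact ⟨_, ⟨⟨h, hS.mem h hh⟩, hh, rfl⟩,
      (mon_add k _ (expE b e l β) ⟨h, hS.mem h hh⟩).symm⟩

lemma Bounds.idealQ_eq {k : Type*} [Field k] {b c e l r : ℕ} {β : ℕ → ℕ}
    (hB : Bounds b c e l β r) : idealQ k b e l β =
      monIdeal k (semigroupH b e l β) ((e + ·) '' filt b e l β r 0) := by
  rw [← idealQ_mul_monIdeal (hB.isSemigroupIdeal_filt 0), ← hB.maximalIdeal_pow, pow_zero, mul_one]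

/-! ### One-dimensional Cohen-Macaulay local rings -/

section DimensionOne

variable {R : Type*} [CommRing R]

lemma one_le_ringKrullDim [IsLocalRing R] {x : R} (hx : x ∈ IsLocalRing.maximalIdeal R)
    (hreg : x ∈ nonZeroDivisors R) : 1 ≤ ringKrullDim R := by
  have h := ringKrullDim_quotient_succ_le_of_nonZeroDivisor hreg
  have hne : Ideal.span {x} ≠ ⊤ := fun h' => by
    rw [Ideal.span_singleton_eq_top] at h'
    exact (IsLocalRing.mem_maximalIdeal x).1 hx h'
  have : Nontrivial (R ⧸ Ideal.span {x}) := Ideal.Quotient.nontrivial_iff.2 hne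
  have h0 : (0 : WithBot ℕ∞) ≤ ringKrullDim (R ⧸ Ideal.span {x}) := ringKrullDim_nonneg_of_nontrivial
  calc (1 : WithBot ℕ∞) = 0 + 1 := (zero_add 1).symm
    _ ≤ _ := add_le_add_left h0 1
    _ ≤ _ := h

/-- Krull's principal ideal theorem: the maximal ideal is a minimal prime of `(x)`. -/
lemma ringKrullDim_le_one_of_le_radical [IsLocalRing R] [IsNoetherianRing R] {x : R}
    (hx : x ∈ IsLocalRing.maximalIdeal R)
    (h : IsLocalRing.maximalIdeal R ≤ (Ideal.span {x}).radical) : ringKrullDim R ≤ 1 := by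
  rw [← IsLocalRing.maximalIdeal_height_eq_ringKrullDim]
  have h1 : IsLocalRing.maximalIdeal R ∈ (Ideal.span {x}).minimalPrimes := by
    refine ⟨⟨inferInstance, ?_⟩, ?_⟩
    · rwa [Ideal.span_le, Set.singleton_subset_iff]
    · rintro J ⟨hJ, hxJ⟩ _
      exact h.trans (hJ.radical_le_iff.2 hxJ)
  have := Ideal.height_le_one_of_isPrincipal_of_mem_minimalPrimes _ _ h1
  exact_mod_cast this

lemma isCohenMacaulayLocal_of_mem_nonZeroDivisors [IsLocalRing R] [IsNoetherianRing R]
    (hdim : ringKrullDim R ≤ 1) {x : R} (hx : x ∈ IsLocalRing.maximalIdeal R)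
    (hreg : x ∈ nonZeroDivisors R) : IsCohenMacaulayLocal R := by
  refine ⟨inferInstance, inferInstance, [x], by simpa using hx, ?_, ?_⟩
  · refine RingTheory.Sequence.IsRegular.of_isWeaklyRegular_of_mem_maximalIdeal R
      (by simpa using hx) ?_
    rw [RingTheory.Sequence.isWeaklyRegular_singleton_iff]
    intro a b hab
    have h0 : (a - b) * x = 0 := by
      have hab' : x * a = x * b := hab
      rw [sub_mul, mul_comm a, mul_comm b, hab', sub_self]
    exact sub_eq_zero.1 (hreg.2 _ h0)
  · rw [le_antisymm hdim (one_le_ringKrullDim hx hreg)]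
    rfl

lemma exists_mem_nonZeroDivisors_of_isCohenMacaulayLocal [IsLocalRing R]
    (h : IsCohenMacaulayLocal R) (hdim : ringKrullDim R ≠ 0) :
    ∃ x ∈ IsLocalRing.maximalIdeal R, x ∈ nonZeroDivisors R := by
  obtain ⟨_, _, rs, hmem, hreg, hlen⟩ := h
  cases rs with
  | nil => exact absurd hlen.symm (by simpa using hdim)
  | cons x rs =>
    refine ⟨x, hmem x List.mem_cons_self, ?_⟩
    have h1 := ((RingTheory.Sequence.isWeaklyRegular_cons_iff R x rs).1 hreg.toIsWeaklyRegular).1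
    rw [mem_nonZeroDivisors_iff_right]
    intro z hz
    refine h1 ?_
    simp only [smul_eq_mul, mul_zero]
    rw [mul_comm]
    exact hz

end DimensionOne

/-! ### The ideals `Q` and `𝔪ʲ` -/

lemma mul_add_inj {e q n q' n' : ℕ} (hn : n < e) (hn' : n' < e) :
    q * e + n = q' * e + n' ↔ q = q' ∧ n = n' := by
  refine ⟨fun h => ?_, fun h => by rw [h.1, h.2]⟩
  have h1 := congrArg (· / e) h
  have h2 := congrArg (· % e) h
  simp only [mul_add_div_self _ hn, mul_add_div_self _ hn', mul_add_mod_self _ hn,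
    mul_add_mod_self _ hn'] at h1 h2
  exact ⟨h1, h2⟩

namespace Bounds

variable {b c e l r : ℕ} {β : ℕ → ℕ}

lemma image_add_subset (hB : Bounds b c e l β r) (j : ℕ) :
    (e + ·) '' filt b e l β r j ⊆ filt b e l β r (j + 1) := by
  intro h hh
  obtain ⟨q, n, hn, rfl⟩ := exists_eq_mul_add hB.e_pos h
  rw [mem_image_add_filt hn] at hh
  obtain ⟨q, rfl⟩ := Nat.exists_eq_add_of_lt (show 0 < q by omega)
  rw [mem_filt hn]
  have := hB.ordAt_add_one (q := q) (n := n)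
  simp only [Nat.zero_add, Nat.add_sub_cancel] at *
  exact ⟨by omega, by push_cast; omega⟩

/-- The complement of e + H in H consists of the Apéry elements, whose orders are n for n ≤ ℓ and 1
for n > ℓ; none exceeds ℓ. -/
lemma filt_subset_image (hB : Bounds b c e l β r) :
    filt b e l β r (l + 1) ⊆ (e + ·) '' filt b e l β r 0 := by
  intro h hh
  obtain ⟨q, n, hn, rfl⟩ := exists_eq_mul_add hB.e_pos h
  rw [mem_filt hn] at hh
  have hup := hB.upper n
  have h2 := hB.two_le_l
  rw [mem_image_add_filt hn]
  have key : apery b l β n + 1 ≤ q := by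
    unfold apery ordAt at *
    split_ifs at * <;> omega
  exact ⟨key, by exact_mod_cast ordAt_nonneg (by omega)⟩

lemma not_filt_subset_image (hB : Bounds b c e l β r) :
    ¬ filt b e l β r l ⊆ (e + ·) '' filt b e l β r 0 := by
  intro h
  have hle : l < e := by have := hB.l_le_r; have := hB.r_lt; omega
  have h1 : (b * l) * e + l ∈ filt b e l β r l := by
    rw [mem_filt hle, apery, ordAt, if_pos le_rfl, if_pos (Or.inl le_rfl)]
    omega
  have h2 := (mem_image_add_filt hle).1 (h h1)
  rw [apery, if_pos le_rfl] at h2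
  omega

/-- Order above r forces all jumps to lie behind: for n ≤ r it gives q > b n, and there subtracting
e lowers the order by exactly one. -/
lemma filt_succ_eq_image (hB : Bounds b c e l β r) {j : ℕ} (hj : r ≤ j) :
    filt b e l β r (j + 1) = (e + ·) '' filt b e l β r j := by
  refine Set.Subset.antisymm ?_ (hB.image_add_subset j)
  intro h hh
  obtain ⟨q, n, hn, rfl⟩ := exists_eq_mul_add hB.e_pos h
  rw [mem_filt hn] at hh
  have hup := hB.upper n
  have h2 := hB.two_le_l
  have h3 := hB.l_le_r
  rw [mem_image_add_filt hn]
  unfold apery ordAt at *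
  split_ifs at * <;> omega

lemma not_filt_subset_image_pred (hB : Bounds b c e l β r) :
    ¬ filt b e l β r r ⊆ (e + ·) '' filt b e l β r (r - 1) := by
  intro h
  have h3 := hB.l_le_r
  have h2 := hB.two_le_l
  have hup := hB.upper r
  have hre := hB.r_lt
  have hla := hB.large r
  -- The exponent of the r-th power of the generator of exponent b e + 1; removing e either leaves
  -- `H` (if r = ℓ) or drops the order to b r - b_r ≤ r - 2.
  have h1 : (b * r) * e + r ∈ filt b e l β r r := by
    rw [mem_filt hre, ordAt, if_pos (Or.inr ⟨le_rfl, le_rfl⟩)]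
    unfold apery
    split_ifs <;> omega
  have h2 := (mem_image_add_filt hre).1 (h h1)
  unfold apery ordAt at h2
  split_ifs at h2 <;> omega

lemma image_inter_filt_two (hB : Bounds b c e l β r) :
    (e + ·) '' filt b e l β r 0 ∩ filt b e l β r 2 = (e + ·) '' filt b e l β r 1 := by
  refine Set.Subset.antisymm ?_ (Set.subset_inter ?_ (hB.image_add_subset 1))
  · rintro h ⟨h1, h2⟩
    obtain ⟨q, n, hn, rfl⟩ := exists_eq_mul_add hB.e_pos h
    rw [mem_filt hn] at h2
    rw [mem_image_add_filt hn] at h1 ⊢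
    have hup := hB.upper n
    refine ⟨h1.1, ?_⟩
    unfold apery ordAt at *
    split_ifs at * <;> omega
  · exact Set.image_mono (filt_anti (by omega))

/-- Among the Apéry elements only the one with n = 2 has order exactly two, which is the stretched
condition. -/
lemma mem_filt_two_union_iff (hB : Bounds b c e l β r) (h : ℕ) :
    h ∈ filt b e l β r 2 ∪ (e + ·) '' filt b e l β r 0 ↔
      h ∈ filt b e l β r 3 ∪ (e + ·) '' filt b e l β r 0 ∨ h ∈ ({b * 2 * e + 2} : Finset ℕ) := by
  have h2 := hB.two_le_l
  have h3 := hB.l_le_r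
  have h4 := hB.r_lt
  obtain ⟨q, n, hn, rfl⟩ := exists_eq_mul_add hB.e_pos h
  rw [Set.mem_union, Set.mem_union, mem_filt hn, mem_filt hn, mem_image_add_filt hn,
    Finset.mem_singleton, mul_add_inj hn (by omega)]
  have hup := hB.upper n
  have key : (n = 2 → b * n = b * 2) := by rintro rfl; rfl
  unfold apery ordAt
  split_ifs <;> omega

lemma not_mem_filt_three_union (hB : Bounds b c e l β r) :
    b * 2 * e + 2 ∉ filt b e l β r 3 ∪ (e + ·) '' filt b e l β r 0 := by
  have h2 := hB.two_le_l
  have h3 := hB.l_le_r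
  have h4 := hB.r_lt
  have hn : 2 < e := by omega
  rw [Set.mem_union, mem_filt hn, mem_image_add_filt hn, apery, if_pos h2, ordAt,
    if_pos (Or.inl h2)]
  omega

/-- The exponents of the monomials in the socle of `A / Q`, together with those in `Q`. -/
lemma socle_iff (hB : Bounds b c e l β r) (h : ℕ) :
    (∀ s ∈ filt b e l β r 1, h + s ∈ (e + ·) '' filt b e l β r 0) ∧ h ∈ semigroupH b e l β ↔
      h ∈ (e + ·) '' filt b e l β r 0 ∨
        h ∈ (Finset.Ico l e).image (fun n => apery b l β n * e + n) := by
  have hI := (hB.isSemigroupIdeal_filt 0).image_add (expE b e l β).2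
  have h2 := hB.two_le_l
  have h3 := hB.l_le_r
  have h4 := hB.r_lt
  have hc := hB.c_lt
  have hmem0 : ∀ {q n : ℕ}, n < e →
      (q * e + n ∈ (e + ·) '' filt b e l β r 0 ↔ apery b l β n + 1 ≤ q) := by
    intro q n hn
    rw [mem_image_add_filt hn]
    refine ⟨fun h => h.1, fun h => ⟨h, ?_⟩⟩
    exact_mod_cast ordAt_nonneg (by omega)
  obtain ⟨q, n, hn, rfl⟩ := exists_eq_mul_add hB.e_pos h
  rw [hmem0 hn, hB.mem_semigroupH_iff hn, Finset.mem_image]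
  have himage : (∃ a ∈ Finset.Ico l e, apery b l β a * e + a = q * e + n) ↔
      l ≤ n ∧ apery b l β n = q := by
    constructor
    · rintro ⟨a, ha, heq⟩
      rw [Finset.mem_Ico] at ha
      rw [mul_add_inj ha.2 hn] at heq
      obtain ⟨h5, rfl⟩ := heq
      exact ⟨ha.1, h5⟩
    · rintro ⟨h5, rfl⟩
      exact ⟨n, Finset.mem_Ico.2 ⟨h5, hn⟩, rfl⟩
  rw [himage]
  constructor
  · rintro ⟨hs, hq⟩
    by_contra hcon
    have hq' : q = apery b l β n := by omega
    have hnl : n < l := by omega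
    -- Below ℓ, adding b e + 1 leads from one Apéry element to the next, hence stays outside e + H.
    have hu : b * e + 1 ∈ filt b e l β r 1 := by
      rw [hB.filt_one]
      exact ⟨AddSubmonoid.subset_closure (Or.inl (Or.inr rfl)), by omega⟩
    have h5 := hs _ hu
    rw [show q * e + n + (b * e + 1) = (q + b) * e + (n + 1) by ring, hmem0 (by omega), hq',
      apery, apery, if_pos (by omega), if_pos (by omega), Nat.mul_add] at h5
    omega
  · intro hor
    have hq : apery b l β n ≤ q := by omega
    have hqH := (hB.mem_semigroupH_iff hn).2 hq
    refine ⟨fun s hs => ?_, hq⟩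
    rcases hor with hQ | ⟨hln, rfl⟩
    · exact hI.add_mem _ ((hmem0 hn).2 hQ) s ((hB.isSemigroupIdeal_filt 1).mem s hs)
    -- From n ≥ ℓ on, every generator moves the Apéry element into e + H, and so does every sum of
    -- generators.
    · rw [hB.filt_one] at hs
      obtain ⟨hsH, hs0⟩ := hs
      revert hs0
      induction hsH using AddSubmonoid.closure_induction with
      | zero => exact fun h => absurd rfl h
      | add x y hx hy ihx ihy =>
        intro h0
        by_cases hx0 : x = 0
        · rw [hx0, Nat.zero_add]
          exact ihy (by omega)
        · rw [← Nat.add_assoc]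
          exact hI.add_mem _ (ihx hx0) _ hy
      | mem g hg =>
        intro _
        rcases hg with (rfl | rfl) | ⟨m, hm, hme, rfl⟩
        · rw [show apery b l β n * g + n + g = (apery b l β n + 1) * g + n by ring, hmem0 hn]
        · by_cases hne : n + 1 < e
          · have := (hB.apery_add hne le_rfl).2.1 hln
            rwa [show apery b l β n * e + n + (b * e + 1) = (apery b l β n + b) * e + (n + 1) by
              ring, hmem0 hne]
          · have hne' : n + 1 = e := by omega
            have : apery b l β n * e + n + (b * e + 1) = (apery b l β n + b + 1) * e + 0 := by
              calc apery b l β n * e + n + (b * e + 1)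
                  = (apery b l β n + b) * e + (n + 1) := by ring
                _ = _ := by rw [hne']; ring
            rw [this, hmem0 hB.e_pos, apery_zero]
            omega
        · by_cases hne : n + m < e
          · have := (hB.apery_add_gen (by omega) hne le_rfl).2.1 (by omega)
            rwa [show apery b l β n * e + n + (β m * e + m) =
              (apery b l β n + β m) * e + (n + m) by ring, hmem0 hne]
          · obtain ⟨p, hp⟩ := Nat.exists_eq_add_of_le (show e ≤ n + m by omega)
            have := (hB.apery_add_gen_wrap (by omega) hme hn hp le_rfl).1
            have heq : apery b l β n * e + n + (β m * e + m) =
                (apery b l β n + β m + 1) * e + p := by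
              calc apery b l β n * e + n + (β m * e + m)
                  = (apery b l β n + β m) * e + (n + m) := by ring
                _ = _ := by rw [hp]; ring
            rwa [heq, hmem0 (by omega)]

/-- The exponents of the minimal generators. -/
def generators (b e l : ℕ) (β : ℕ → ℕ) : Finset ℕ :=
  (insert 0 (insert 1 (Finset.Ioo l e))).image
    -- The Apéry element of residue 0 is 0, whereas the generator of that residue is e, with
    -- quotient 1.
    (fun n => (if n = 0 then 1 else apery b l β n) * e + n)

lemma card_generators (hB : Bounds b c e l β r) : (generators b e l β).card = e - l + 1 := by
  have h2 := hB.two_le_l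
  have h3 := hB.l_le_r
  have h4 := hB.r_lt
  rw [generators, Finset.card_image_of_injOn, Finset.card_insert_of_notMem,
    Finset.card_insert_of_notMem, Nat.card_Ioo]
  · omega
  · simp only [Finset.mem_Ioo]; omega
  · simp only [Finset.mem_Ioo, Finset.mem_insert]; omega
  · intro x hx y hy hxy
    simp only [Finset.coe_insert, Finset.coe_Ioo, Set.mem_insert_iff, Set.mem_Ioo] at hx hy
    exact ((mul_add_inj (by omega) (by omega)).1 hxy).2

lemma mem_generators (hB : Bounds b c e l β r) {q n : ℕ} (hn : n < e) :
    q * e + n ∈ generators b e l β ↔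
      (n = 0 ∧ q = 1) ∨ (n = 1 ∧ q = b) ∨ (l < n ∧ q = β n) := by
  have h2 := hB.two_le_l
  have h3 := hB.l_le_r
  have h4 := hB.r_lt
  rw [generators, Finset.mem_image]
  constructor
  · rintro ⟨a, ha, heq⟩
    simp only [Finset.mem_insert, Finset.mem_Ioo] at ha
    rw [mul_add_inj (by omega) hn] at heq
    obtain ⟨h5, rfl⟩ := heq
    rcases ha with rfl | rfl | ha
    · simp at h5; omega
    · rw [if_neg (by omega), apery, if_pos (by omega)] at h5
      omega
    · rw [if_neg (by omega), apery, if_neg (by omega)] at h5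
      omega
  · rintro (⟨rfl, rfl⟩ | ⟨rfl, rfl⟩ | ⟨hl, rfl⟩)
    · exact ⟨0, by simp, by simp⟩
    · refine ⟨1, by simp, ?_⟩
      rw [if_neg (by omega), apery, if_pos (by omega), Nat.mul_one]
    · refine ⟨n, by simp [hl, hn], ?_⟩
      rw [if_neg (by omega), apery, if_neg (by omega)]

lemma mem_filt_one_iff (hB : Bounds b c e l β r) (h : ℕ) :
    h ∈ filt b e l β r 1 ↔ h ∈ filt b e l β r 2 ∨ h ∈ generators b e l β := by
  have h2 := hB.two_le_l
  have h3 := hB.l_le_r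
  obtain ⟨q, n, hn, rfl⟩ := exists_eq_mul_add hB.e_pos h
  rw [mem_filt hn, mem_filt hn, hB.mem_generators hn]
  have hup := hB.upper n
  have key0 : (n = 0 → b * n = 0) := by rintro rfl; rfl
  have key1 : (n = 1 → b * n = b) := by rintro rfl; omega
  unfold apery ordAt
  split_ifs <;> omega

lemma not_mem_filt_two (hB : Bounds b c e l β r) (h : ℕ) (hh : h ∈ generators b e l β) :
    h ∉ filt b e l β r 2 := by
  have h2 := hB.two_le_l
  have h3 := hB.l_le_r
  obtain ⟨q, n, hn, rfl⟩ := exists_eq_mul_add hB.e_pos h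
  rw [hB.mem_generators hn] at hh
  rw [mem_filt hn]
  have hup := hB.upper n
  have key0 : (n = 0 → b * n = 0) := by rintro rfl; rfl
  have key1 : (n = 1 → b * n = b) := by rintro rfl; omega
  unfold apery ordAt
  split_ifs <;> omega

/-- The number of elements of `H` that are congruent to `n` modulo `e` and not in `filt (N + 1)`. -/
def gap (b l : ℕ) (β : ℕ → ℕ) (r N n : ℕ) : ℕ :=
  -- Number of q from the Apéry bound up to the last one of order at most N. For N ≥ r - 1 the
  -- subtractions are not truncated, and the values q < b n with ℓ < n ≤ r all count since their
  -- order is at most n - 2.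
  if n ≤ l then N + 1 - n else if n ≤ r then N + 1 - n + (b * n - β n) else N

/-- The exponents of the monomials in the complement of `𝔪ᴺ⁺¹`. -/
def complement (b e l : ℕ) (β : ℕ → ℕ) (r N : ℕ) : Finset ℕ :=
  ((Finset.range e).sigma fun n => Finset.Ico (apery b l β n)
    (apery b l β n + gap b l β r N n)).image (fun p => p.2 * e + p.1)

lemma mem_complement {N q n : ℕ} (hn : n < e) : q * e + n ∈ complement b e l β r N ↔
    apery b l β n ≤ q ∧ q < apery b l β n + gap b l β r N n := by
  rw [complement, Finset.mem_image]
  constructor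
  · rintro ⟨⟨a, q'⟩, ha, heq⟩
    simp only [Finset.mem_sigma, Finset.mem_range, Finset.mem_Ico] at ha
    rw [mul_add_inj ha.1 hn] at heq
    obtain ⟨rfl, rfl⟩ := heq
    exact ha.2
  · intro h
    exact ⟨⟨n, q⟩, by simpa using ⟨hn, h⟩, rfl⟩

lemma card_complement (N : ℕ) :
    (complement b e l β r N).card = ∑ n ∈ Finset.range e, gap b l β r N n := by
  rw [complement, Finset.card_image_of_injOn, Finset.card_sigma]
  · simp
  · rintro ⟨a, q⟩ ha ⟨a', q'⟩ ha' heq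
    simp only [Finset.coe_sigma, Set.mem_sigma_iff, Finset.coe_range, Set.mem_Iio] at ha ha'
    obtain ⟨h1, h2⟩ := (mul_add_inj ha.1 ha'.1).1 heq
    simp only at h1 h2
    subst h1 h2
    rfl

lemma mem_filt_zero_iff (hB : Bounds b c e l β r) {N : ℕ} (h : ℕ) :
    h ∈ (semigroupH b e l β : Set ℕ) ↔
      h ∈ filt b e l β r (N + 1) ∨ h ∈ complement b e l β r N := by
  have h2 := hB.two_le_l
  have h3 := hB.l_le_r
  obtain ⟨q, n, hn, rfl⟩ := exists_eq_mul_add hB.e_pos h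
  rw [SetLike.mem_coe, mem_filt hn, mem_complement hn, hB.mem_semigroupH_iff hn]
  have hup := hB.upper n
  have hla := hB.large n
  unfold apery ordAt gap
  split_ifs <;> omega

lemma not_mem_filt_of_mem_complement (hB : Bounds b c e l β r) {N : ℕ} (hN : r - 1 ≤ N) (h : ℕ)
    (hh : h ∈ complement b e l β r N) : h ∉ filt b e l β r (N + 1) := by
  have h2 := hB.two_le_l
  have h3 := hB.l_le_r
  obtain ⟨q, n, hn, rfl⟩ := exists_eq_mul_add hB.e_pos h
  rw [mem_complement hn] at hh
  rw [mem_filt hn]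
  have hup := hB.upper n
  have hla := hB.large n
  unfold apery ordAt gap at *
  split_ifs at * <;> omega

lemma sum_gap (hB : Bounds b c e l β r) {N : ℕ} (hN : r - 1 ≤ N) :
    ((∑ n ∈ Finset.range e, gap b l β r N n : ℕ) : ℤ) =
      (e : ℤ) * (N + 1) - ((e : ℤ) - 1 + (l.choose 2 : ℤ) +
        ∑ m ∈ Finset.Icc (l + 1) r, ((β m : ℤ) - b * m + m - 1)) := by
  have h2 := hB.two_le_l
  have h3 := hB.l_le_r
  have h4 := hB.r_lt
  have hlow : ∑ n ∈ Finset.range (l + 1), ((gap b l β r N n : ℕ) : ℤ) =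
      (l + 1) * (N + 1) - (l + (l.choose 2 : ℤ)) := by
    have h5 : ∀ m, m ≤ l → ∑ n ∈ Finset.range (m + 1), ((gap b l β r N n : ℕ) : ℤ) =
        (m + 1) * (N + 1) - (m + (m.choose 2 : ℤ)) := by
      intro m
      induction m with
      | zero => intro _; simp [gap]
      | succ m ih =>
        intro hm
        rw [Finset.sum_range_succ, ih (by omega), gap, if_pos hm, Nat.cast_sub (by omega),
          Nat.choose_succ_succ' m 1, Nat.choose_one_right]
        push_cast
        ring
    exact h5 l le_rfl
  have hmid : ∀ m, l ≤ m → m ≤ r → ∑ n ∈ Finset.range (m + 1), ((gap b l β r N n : ℕ) : ℤ) =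
      (m + 1) * (N + 1) - (m + (l.choose 2 : ℤ) +
        ∑ i ∈ Finset.Icc (l + 1) m, ((β i : ℤ) - b * i + i - 1)) := by
    intro m hm
    induction m, hm using Nat.le_induction with
    | base =>
      intro _
      rw [hlow, Finset.Icc_eq_empty (by omega), Finset.sum_empty, add_zero]
    | succ m hm ih =>
      intro hmr
      have hup := hB.upper (m + 1) (by omega) (by omega)
      rw [Finset.sum_range_succ, ih (by omega), gap, if_neg (by omega), if_pos hmr,
        ← Finset.insert_Icc_right_eq_Icc_add_one (by omega), Finset.sum_insert (by simp),
        Nat.cast_add, Nat.cast_sub (by omega), Nat.cast_sub (by omega)]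
      push_cast
      ring
  have hhigh : ∀ m, r ≤ m → ∑ n ∈ Finset.range (m + 1), ((gap b l β r N n : ℕ) : ℤ) =
      (m + 1) * (N + 1) - (m + (l.choose 2 : ℤ) +
        ∑ i ∈ Finset.Icc (l + 1) r, ((β i : ℤ) - b * i + i - 1)) := by
    intro m hm
    induction m, hm using Nat.le_induction with
    | base => exact hmid r h3 le_rfl
    | succ m hm ih =>
      rw [Finset.sum_range_succ, ih, gap, if_neg (by omega), if_neg (by omega)]
      push_cast
      ring
  have := hhigh (e - 1) (by omega)
  rw [Nat.sub_add_cancel (by omega), Nat.cast_sub (by omega)] at this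
  rw [Nat.cast_sum, this]
  push_cast
  ring

/-- The two sets differ exactly when some jump starts at order j - 1. The jump at n starts at order
b n - b_n, and the exponent b n e + n just after it is the witness. -/
lemma image_inter_filt_ne_iff (hB : Bounds b c e l β r) {j : ℕ} (hj : 1 ≤ j) :
    (e + ·) '' filt b e l β r (j - 1) ∩ filt b e l β r (j + 1) ≠ (e + ·) '' filt b e l β r j ↔
      ∃ n, l + 1 ≤ n ∧ n ≤ r ∧ j + β n = b * n + 1 := by
  have hre := hB.r_lt
  constructor
  · intro h
    by_contra! hcon
    refine h (Set.Subset.antisymm ?_ (Set.subset_inter (Set.image_mono (filt_anti (by omega)))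
      (hB.image_add_subset j)))
    rintro h ⟨h1, h2⟩
    obtain ⟨q, n, hn, rfl⟩ := exists_eq_mul_add hB.e_pos h
    rw [mem_filt hn] at h2
    rw [mem_image_add_filt hn] at h1 ⊢
    refine ⟨h1.1, ?_⟩
    have hup := hB.upper n
    have hcon := hcon n
    unfold apery ordAt at *
    split_ifs at * <;> omega
  · rintro ⟨n, h1, h2, h3⟩ heq
    have hn : n < e := by omega
    have hup := hB.upper n h1 hn
    have hla := hB.large n h1 h2
    have h4 : (b * n) * e + n ∈ (e + ·) '' filt b e l β r (j - 1) ∩ filt b e l β r (j + 1) := by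
      rw [Set.mem_inter_iff, mem_image_add_filt hn, mem_filt hn]
      unfold apery ordAt
      split_ifs <;> omega
    rw [heq, mem_image_add_filt hn] at h4
    unfold apery ordAt at h4
    split_ifs at h4 <;> omega

end Bounds

/-! ### Invariants of the local ring read off from the order filtration. -/

lemma isNoetherianRing_ringA (k : Type*) [Field k] (b e l : ℕ) (β : ℕ → ℕ) :
    IsNoetherianRing (RingA k b e l β) := by
  refine isNoetherianRing_local (H := semigroupH b e l β) rfl ?_
  refine Set.Finite.union (Set.toFinite _) (((Set.finite_Iio e).image fun n => β n * e + n).subset ?_)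
  rintro _ ⟨n, _, hn, rfl⟩
  exact ⟨n, hn, rfl⟩

/-- The element `uᵉ` of `A`. -/
def elemE (k : Type*) [Field k] (b e l : ℕ) (β : ℕ → ℕ) : RingA k b e l β :=
  mon k (semigroupH b e l β) (expE b e l β)

namespace Bounds

variable {b c e l r : ℕ} {β : ℕ → ℕ} {k : Type*} [Field k]

lemma idealQ_mul_pow (hB : Bounds b c e l β r) (j : ℕ) :
    idealQ k b e l β * idealM k b e l β ^ j =
      monIdeal k (semigroupH b e l β) ((e + ·) '' filt b e l β r j) := by
  rw [hB.maximalIdeal_pow, idealQ_mul_monIdeal (hB.isSemigroupIdeal_filt j)]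

lemma isSemigroupIdeal_image (hB : Bounds b c e l β r) (j : ℕ) :
    IsSemigroupIdeal (semigroupH b e l β) ((e + ·) '' filt b e l β r j) :=
  (hB.isSemigroupIdeal_filt j).image_add (expE b e l β).2

lemma idealQ_le (hB : Bounds b c e l β r) : idealQ k b e l β ≤ idealM k b e l β := by
  rw [hB.idealQ_eq, hB.idealM_eq]
  exact monIdeal_mono (hB.image_add_subset 0)

lemma elemE_mem (hB : Bounds b c e l β r) : elemE k b e l β ∈ idealM k b e l β :=
  hB.idealQ_le (Ideal.mem_span_singleton_self _)

lemma pow_le_idealQ_iff (hB : Bounds b c e l β r) (j : ℕ) :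
    idealM k b e l β ^ j ≤ idealQ k b e l β ↔
      filt b e l β r j ⊆ (e + ·) '' filt b e l β r 0 := by
  rw [hB.maximalIdeal_pow, hB.idealQ_eq,
    monIdeal_le_iff (hB.isSemigroupIdeal_filt j) (hB.isSemigroupIdeal_image 0)]

lemma pow_succ_eq_iff (hB : Bounds b c e l β r) (j : ℕ) :
    idealM k b e l β ^ (j + 1) = idealQ k b e l β * idealM k b e l β ^ j ↔
      filt b e l β r (j + 1) = (e + ·) '' filt b e l β r j := by
  rw [hB.idealQ_mul_pow, hB.maximalIdeal_pow,
    monIdeal_inj (hB.isSemigroupIdeal_filt _) (hB.isSemigroupIdeal_image j)]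

lemma radical_idealQ (hB : Bounds b c e l β r) :
    (idealQ k b e l β).radical = idealM k b e l β := by
  apply le_antisymm
  · exact (Ideal.radical_mono hB.idealQ_le).trans
      (Ideal.IsPrime.radical (IsLocalRing.maximalIdeal.isMaximal _).isPrime).le
  · exact fun x hx => ⟨l + 1, (hB.pow_le_idealQ_iff (l + 1)).2 hB.filt_subset_image
      (Ideal.pow_mem_pow hx _)⟩

lemma ringKrullDim_ringA (hB : Bounds b c e l β r) : ringKrullDim (RingA k b e l β) = 1 := by
  have := isNoetherianRing_ringA k b e l β
  refine le_antisymm (ringKrullDim_le_one_of_le_radical hB.elemE_mem hB.radical_idealQ.ge)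
    (one_le_ringKrullDim hB.elemE_mem (mem_nonZeroDivisors_of_ne_zero (mon_ne_zero _)))

lemma isCohenMacaulayLocal_ringA (hB : Bounds b c e l β r) :
    IsCohenMacaulayLocal (RingA k b e l β) := by
  have := isNoetherianRing_ringA k b e l β
  exact isCohenMacaulayLocal_of_mem_nonZeroDivisors hB.ringKrullDim_ringA.le hB.elemE_mem
    (mem_nonZeroDivisors_of_ne_zero (mon_ne_zero _))

lemma isNilpotencyIndex (hB : Bounds b c e l β r) :
    IsNilpotencyIndex (idealQ k b e l β) (idealM k b e l β) l := by
  refine ⟨(hB.pow_le_idealQ_iff (l + 1)).2 hB.filt_subset_image, ?_⟩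
  intro n hn
  by_contra hlt
  refine hB.not_filt_subset_image ((hB.pow_le_idealQ_iff (k := k) l).1 ?_)
  exact (Ideal.pow_le_pow_right (by omega)).trans hn

lemma isReductionNumber (hB : Bounds b c e l β r) :
    IsReductionNumber (idealQ k b e l β) (idealM k b e l β) r := by
  refine ⟨(hB.pow_succ_eq_iff r).2 (hB.filt_succ_eq_image le_rfl), ?_⟩
  intro n hn
  rw [Set.mem_ofPred_eq] at hn
  by_contra hlt
  -- An equality at n persists for all larger exponents, so it would hold at r - 1.
  have h1 : ∀ i, idealM k b e l β ^ (n + i + 1) = idealQ k b e l β * idealM k b e l β ^ (n + i) := by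
    intro i
    rw [show n + i + 1 = n + 1 + i by ring, pow_add, hn, pow_add, mul_assoc]
  have h2 := h1 (r - 1 - n)
  rw [show n + (r - 1 - n) = r - 1 by omega, hB.pow_succ_eq_iff,
    show r - 1 + 1 = r by omega] at h2
  exact hB.not_filt_subset_image_pred h2.le

lemma isStretched (hB : Bounds b c e l β r) :
    IsStretched (idealQ k b e l β) (idealM k b e l β) := by
  refine ⟨⟨hB.radical_idealQ, {elemE k b e l β}, ?_, ?_⟩, ⟨hB.idealQ_le, r, ?_⟩, ?_, ?_⟩
  · rw [hB.ringKrullDim_ringA]; rfl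
  · rw [Finset.coe_singleton]; rfl
  · exact hB.isReductionNumber.1
  · have := hB.idealQ_mul_pow (k := k) 1
    rw [pow_one] at this
    rw [this, ← hB.image_inter_filt_two,
      ← monIdeal_inf (hB.isSemigroupIdeal_image 0) (hB.isSemigroupIdeal_filt 2),
      ← hB.idealQ_eq, ← hB.maximalIdeal_pow]
  · rw [hB.maximalIdeal_pow, hB.maximalIdeal_pow, hB.idealQ_eq, monIdeal_sup, monIdeal_sup,
      quotLength_monIdeal {b * 2 * e + 2}
        ((hB.isSemigroupIdeal_filt 2).union (hB.isSemigroupIdeal_image 0))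
        ((hB.isSemigroupIdeal_filt 3).union (hB.isSemigroupIdeal_image 0))
        hB.mem_filt_two_union_iff]
    · simp
    · intro n hn
      rw [Finset.mem_singleton] at hn
      rw [hn]
      exact hB.not_mem_filt_three_union

lemma cmType_eq (hB : Bounds b c e l β r) :
    cmType (idealQ k b e l β) = ((e - l : ℕ) : ℕ∞) := by
  have hIQ := hB.isSemigroupIdeal_image 0
  let S : Set ℕ := {h | (∀ s ∈ filt b e l β r 1, h + s ∈ (e + ·) '' filt b e l β r 0) ∧
    h ∈ semigroupH b e l β}
  have hS : IsSemigroupIdeal (semigroupH b e l β) S := by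
    refine ⟨fun h hh => hh.2, fun h hh t ht => ⟨fun s hs => ?_, add_mem hh.2 ht⟩⟩
    rw [Nat.add_right_comm]
    exact hIQ.add_mem _ (hh.1 s hs) t ht
  have hcolon : (idealQ k b e l β).colon (idealM k b e l β : Set (RingA k b e l β)) =
      monIdeal k (semigroupH b e l β) S := by
    ext a
    rw [hB.idealQ_eq, hB.idealM_eq, mem_colon_monIdeal_iff hIQ (hB.isSemigroupIdeal_filt 1).mem,
      mem_monIdeal_iff hS]
    constructor
    · intro h n hn
      by_cases hnH : n ∈ semigroupH b e l β
      · have : ¬ ∀ s ∈ filt b e l β r 1, n + s ∈ (e + ·) '' filt b e l β r 0 :=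
          fun h' => hn ⟨h', hnH⟩
        push Not at this
        obtain ⟨s, hs, hns⟩ := this
        exact h n s hs hns
      · exact coeff_expand_eq_zero a n hnH
    · intro h n s hs hns
      exact h n fun h' => hns (h'.1 s hs)
  rw [cmType, hcolon, hB.idealQ_eq, quotLength_monIdeal _ hS hIQ hB.socle_iff]
  · rw [Finset.card_image_of_injOn, Nat.card_Ico]
    intro x hx y hy hxy
    rw [Finset.coe_Ico, Set.mem_Ico] at hx hy
    exact ((mul_add_inj hx.2 hy.2).1 hxy).2
  · intro n hn
    obtain ⟨m, hm, rfl⟩ := Finset.mem_image.1 hn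
    rw [mem_image_add_filt (Finset.mem_Ico.1 hm).2]
    omega

lemma spanFinrank_eq (hB : Bounds b c e l β r) :
    (idealM k b e l β).spanFinrank = e - l + 1 := by
  have := isNoetherianRing_ringA k b e l β
  have h : ((idealM k b e l β).spanFinrank : ℕ∞) =
      quotLength (idealM k b e l β) (idealM k b e l β ^ 2) := quotLength_maximalIdeal_sq
  rw [hB.maximalIdeal_pow, hB.idealM_eq, quotLength_monIdeal _ (hB.isSemigroupIdeal_filt 1)
    (hB.isSemigroupIdeal_filt 2) hB.mem_filt_one_iff hB.not_mem_filt_two,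
    hB.card_generators] at h
  rw [hB.idealM_eq]
  exact_mod_cast h

lemma length_quotient_pow (hB : Bounds b c e l β r) {N : ℕ} (hN : r - 1 ≤ N) :
    Module.length (RingA k b e l β) (RingA k b e l β ⧸ idealM k b e l β ^ (N + 1)) =
      ((∑ n ∈ Finset.range e, gap b l β r N n : ℕ) : ℕ∞) := by
  rw [length_quotient_eq, ← monIdeal_univ, hB.maximalIdeal_pow,
    quotLength_monIdeal _ isSemigroupIdeal_self (hB.isSemigroupIdeal_filt _)
      hB.mem_filt_zero_iff (hB.not_mem_filt_of_mem_complement hN), card_complement]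

lemma mem_Lam_iff (hB : Bounds b c e l β r) (j : ℕ) :
    j ∈ Lam (idealQ k b e l β) (idealM k b e l β) ↔
      1 ≤ j ∧ ∃ n, l + 1 ≤ n ∧ n ≤ r ∧ j + β n = b * n + 1 := by
  rw [Lam, Set.mem_ofPred_eq]
  refine and_congr_right fun hj => ?_
  rw [hB.idealQ_mul_pow, hB.idealQ_mul_pow, hB.maximalIdeal_pow,
    monIdeal_inf (hB.isSemigroupIdeal_image _) (hB.isSemigroupIdeal_filt _), ne_eq,
    monIdeal_inj ((hB.isSemigroupIdeal_image _).inter (hB.isSemigroupIdeal_filt _))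
      (hB.isSemigroupIdeal_image _), ← ne_eq, hB.image_inter_filt_ne_iff hj]

lemma image_Lam (hB : Bounds b c e l β r) :
    (fun n : ℕ => (n : ℤ)) '' Lam (idealQ k b e l β) (idealM k b e l β) =
      (fun n : ℕ => (b : ℤ) * n - β n + 1) '' Set.Icc (l + 1) r := by
  ext z
  constructor
  · rintro ⟨j, hj, rfl⟩
    obtain ⟨_, n, h1, h2, h3⟩ := (hB.mem_Lam_iff j).1 hj
    refine ⟨n, ⟨h1, h2⟩, ?_⟩
    have h4 : ((j + β n : ℕ) : ℤ) = ((b * n + 1 : ℕ) : ℤ) := by rw [h3]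
    push_cast at h4
    simp only
    linarith
  · rintro ⟨n, ⟨h1, h2⟩, rfl⟩
    have hup := hB.upper n h1 (h2.trans_lt hB.r_lt)
    refine ⟨b * n + 1 - β n, (hB.mem_Lam_iff _).2 ⟨by omega, n, h1, h2, by omega⟩, ?_⟩
    simp only
    rw [Nat.cast_sub (by omega)]
    push_cast
    ring

lemma eq_iff_first_le (hB : Bounds b c e l β r) (hl : l + 1 < e) :
    r = l ↔ (β (l + 1) : ℤ) ≤ (b : ℤ) * l + b - l := by
  have h1 := hB.large (l + 1)
  have h2 := hB.small (l + 1)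
  have h3 := hB.l_le_r
  have h4 : (b : ℤ) * l = ((b * l : ℕ) : ℤ) := by push_cast; rfl
  have h5 : b * (l + 1) = b * l + b := rfl
  omega

end Bounds

/-- For b = 2 and b_n = n + ℓ the inequality b_n > b n - n + 1 reads ℓ > 1, so every index above ℓ
is a jump and r = e - 1. -/
lemma admissible_example {l : ℕ} (hl : 2 ≤ l) (N : ℕ) :
    Admissible 2 (l + N + 1) l (fun n => n + l) ∧
      IsR 2 (l + N + 1) l (fun n => n + l) (l + N) := by
  have hc : ⌈((2 : ℕ) : ℚ) / 2⌉₊ = 1 := by norm_num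
  refine ⟨⟨le_rfl, hl, by omega, ?_, ?_, ?_⟩, ?_, ?_⟩
  · intro n _ _
    rw [hc]
    omega
  · intro _; omega
  · intro n _ _
    rw [hc]
    omega
  · by_cases hN : N = 0
    · exact Or.inr (by rw [hN]; rfl)
    · exact Or.inl ⟨by omega, by omega, by push_cast; omega⟩
  · rintro n (⟨_, h, _⟩ | h)
    · omega
    · have : n = l := h
      omega

/-! ### The associated graded ring -/

section AssociatedGraded

variable {A : Type*} [CommRing A]

/-- A copy of `AssociatedGradedRing I` that instance search does not unfold. -/
def GradedRingOf (I : Ideal A) : Type _ := AssociatedGradedRing I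

instance (I : Ideal A) : CommRing (GradedRingOf I) :=
  inferInstanceAs (CommRing (AssociatedGradedRing I))

/-- The class in `G(I)` of an element of the Rees algebra. -/
def toGraded (I : Ideal A) : reesAlgebra I →+* GradedRingOf I :=
  Ideal.Quotient.mk (I.map (algebraMap A (reesAlgebra I)))

lemma toGraded_surjective (I : Ideal A) : Function.Surjective (toGraded I) :=
  Ideal.Quotient.mk_surjective

lemma toGraded_eq_zero_iff_mem {I : Ideal A} (f : reesAlgebra I) :
    toGraded I f = 0 ↔ f ∈ I.map (algebraMap A (reesAlgebra I)) :=
  Ideal.Quotient.eq_zero_iff_mem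

instance [IsNoetherianRing A] (I : Ideal A) : IsNoetherianRing (GradedRingOf I) :=
  isNoetherianRing_of_surjective _ _ (toGraded I) (toGraded_surjective I)

/-- The homogeneous element `a tⁱ` of the Rees algebra. -/
def reesMonomial {I : Ideal A} (i : ℕ) (a : A) (ha : a ∈ I ^ i) : reesAlgebra I :=
  ⟨monomial i a, reesAlgebra.monomial_mem.2 ha⟩

lemma eq_sum_reesMonomial {I : Ideal A} (f : reesAlgebra I) :
    f = ∑ i : (f : A[X]).support, reesMonomial (i : ℕ) ((f : A[X]).coeff i) (f.2 i) := by
  ext1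
  rw [AddSubmonoidClass.coe_finsetSum]
  conv_lhs => rw [(f : A[X]).as_sum_support, ← Finset.sum_coe_sort]
  rfl

/-- Makes vanishing in G(I) a condition on each coefficient, using that an element of Iⁱ⁺¹ = I · Iⁱ
placed in degree i lies in the extension of I. -/
lemma toGraded_eq_zero_iff {I : Ideal A} (f : reesAlgebra I) :
    toGraded I f = 0 ↔ ∀ i, (f : A[X]).coeff i ∈ I ^ (i + 1) := by
  rw [toGraded_eq_zero_iff_mem]
  constructor
  · intro hf
    refine Submodule.span_induction
      (p := fun (f : reesAlgebra I) _ => ∀ i, (f : A[X]).coeff i ∈ I ^ (i + 1)) ?_ ?_ ?_ ?_ hf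
    · rintro _ ⟨a, ha, rfl⟩ i
      change (C a).coeff i ∈ _
      rw [coeff_C]
      split_ifs with h
      · subst h
        simpa using ha
      · exact zero_mem _
    · intro i
      exact zero_mem _
    · intro x y _ _ hx hy i
      exact add_mem (hx i) (hy i)
    · intro c x _ hx i
      change ((c : A[X]) * (x : A[X])).coeff i ∈ _
      rw [coeff_mul]
      refine Ideal.sum_mem _ fun p hp => ?_
      rw [← Finset.HasAntidiagonal.mem_antidiagonal.1 hp, Nat.add_assoc, pow_add]
      exact Ideal.mul_mem_mul (c.2 _) (hx _)
  · intro hf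
    have key : ∀ i a (ha : a ∈ I ^ (i + 1)),
        reesMonomial i a (Ideal.pow_le_pow_right (Nat.le_succ i) ha) ∈
          I.map (algebraMap A (reesAlgebra I)) := by
      intro i a ha
      have ha' : a ∈ I * I ^ i := by rwa [← pow_succ']
      have hex : ∃ g ∈ I.map (algebraMap A (reesAlgebra I)), (g : A[X]) = monomial i a := by
        refine Submodule.mul_induction_on ha' ?_ ?_
        · intro x hx y hy
          refine ⟨algebraMap A (reesAlgebra I) x * reesMonomial i y hy,
            Ideal.mul_mem_right _ _ (Ideal.mem_map_of_mem _ hx), ?_⟩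
          exact C_mul_monomial
        · rintro x y ⟨g, hg, hgx⟩ ⟨h, hh, hhy⟩
          refine ⟨g + h, add_mem hg hh, ?_⟩
          rw [map_add, ← hgx, ← hhy]
          rfl
      obtain ⟨g, hg, hga⟩ := hex
      have : reesMonomial i a (Ideal.pow_le_pow_right (Nat.le_succ i) ha) = g := Subtype.ext hga.symm
      rwa [this]
    rw [eq_sum_reesMonomial f]
    exact Ideal.sum_mem _ fun i _ => key i _ (hf i)

lemma toGraded_reesMonomial_eq_zero_iff {I : Ideal A} {i : ℕ} {a : A} (ha : a ∈ I ^ i) :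
    toGraded I (reesMonomial i a ha) = 0 ↔ a ∈ I ^ (i + 1) := by
  rw [toGraded_eq_zero_iff]
  constructor
  · intro h
    simpa [reesMonomial] using h i
  · intro h j
    change (monomial i a).coeff j ∈ _
    rw [coeff_monomial]
    split_ifs with hij
    · rwa [← hij]
    · exact zero_mem _

lemma reesMonomial_mul {I : Ideal A} {i j : ℕ} {x y : A} (hx : x ∈ I ^ i) (hy : y ∈ I ^ j) :
    reesMonomial i x hx * reesMonomial j y hy =
      reesMonomial (i + j) (x * y) (by rw [pow_add]; exact Ideal.mul_mem_mul hx hy) := by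
  ext1
  exact monomial_mul_monomial i j x y

lemma reesMonomial_pow {I : Ideal A} {i : ℕ} {x : A} (hx : x ∈ I ^ i) (n : ℕ) :
    reesMonomial i x hx ^ n =
      reesMonomial (i * n) (x ^ n) (by rw [pow_mul]; exact Ideal.pow_mem_pow hx n) := by
  ext1
  change (monomial i x) ^ n = _
  rw [monomial_pow]
  rfl

lemma reesMonomial_add {I : Ideal A} {i : ℕ} {x y : A} (hx : x ∈ I ^ i) (hy : y ∈ I ^ i) :
    reesMonomial i (x + y) (add_mem hx hy) = reesMonomial i x hx + reesMonomial i y hy := by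
  ext1
  exact map_add (monomial i) x y

/-- The initial form in degree one of an element of `I`. -/
def initialForm {I : Ideal A} (x : A) (hx : x ∈ I) : GradedRingOf I :=
  toGraded I (reesMonomial 1 x (by rwa [pow_one]))

lemma initialForm_pow {I : Ideal A} {x : A} (hx : x ∈ I) (n : ℕ) :
    initialForm x hx ^ n = toGraded I (reesMonomial n (x ^ n) (Ideal.pow_mem_pow hx n)) := by
  rw [initialForm, ← map_pow, reesMonomial_pow]
  simp only [one_mul]

lemma initialForm_mem_nonZeroDivisors {I : Ideal A} {x : A} (hx : x ∈ I)
    (h : ∀ i, ∀ a ∈ I ^ i, x * a ∈ I ^ (i + 2) → a ∈ I ^ (i + 1)) :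
    initialForm x hx ∈ nonZeroDivisors (GradedRingOf I) := by
  refine mem_nonZeroDivisors_iff_right.2 fun z hz => ?_
  obtain ⟨f, rfl⟩ := toGraded_surjective _ z
  rw [initialForm, ← map_mul, toGraded_eq_zero_iff] at hz
  refine (toGraded_eq_zero_iff f).2 fun i => h i _ (f.2 i) ?_
  have := hz (i + 1)
  change ((f : A[X]) * monomial 1 x).coeff (i + 1) ∈ _ at this
  rwa [coeff_mul_monomial, mul_comm] at this

/-- The lowest nonzero component of `g` would survive multiplication by the unit component of degree
zero. -/
lemma mem_nonZeroDivisors_of_isUnit_coeff_zero {I : Ideal A} {f : reesAlgebra I}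
    (hf : IsUnit ((f : A[X]).coeff 0)) :
    toGraded I f ∈ nonZeroDivisors (GradedRingOf I) := by
  refine mem_nonZeroDivisors_iff_right.2 fun z hz => ?_
  obtain ⟨g, rfl⟩ := toGraded_surjective _ z
  rw [← map_mul, toGraded_eq_zero_iff] at hz
  refine (toGraded_eq_zero_iff g).2 fun i => ?_
  induction i using Nat.strong_induction_on with
  | _ i ih =>
    have h1 := hz i
    change ((g : A[X]) * (f : A[X])).coeff i ∈ _ at h1
    rw [coeff_mul, ← Finset.add_sum_erase _ _
      (Finset.HasAntidiagonal.mem_antidiagonal.2 (show (i, 0).1 + (i, 0).2 = i from rfl))] at h1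
    rw [← Ideal.mul_unit_mem_iff_mem _ hf]
    refine (Ideal.add_mem_iff_left _ (Ideal.sum_mem _ fun p hp => ?_)).1 h1
    rw [Finset.mem_erase, Finset.HasAntidiagonal.mem_antidiagonal] at hp
    have hlt : p.1 < i := by
      rcases Nat.eq_zero_or_pos p.2 with h0 | h0
      · exact absurd (Prod.ext (by simpa [h0] using hp.2) h0) hp.1
      · omega
    have hp2 := hp.2
    have hmem := Ideal.mul_mem_mul (ih p.1 hlt) (f.2 p.2)
    rwa [← pow_add, show p.1 + 1 + p.2 = i + 1 by omega] at hmem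

end AssociatedGraded

/-! ### Criteria for Cohen-Macaulayness in dimension at most one. -/

section CohenMacaulayRing

variable {G : Type*} [CommRing G]

lemma isCohenMacaulayRing_of_exists_mem_nonZeroDivisors [IsNoetherianRing G]
    (hdim : ringKrullDim G ≤ 1)
    (h : ∀ P : Ideal G, P.IsMaximal → ∃ x ∈ P, x ∈ nonZeroDivisors G) :
    IsCohenMacaulayRing G := by
  refine ⟨inferInstance, fun P hP => ?_⟩
  obtain ⟨x, hxP, hx⟩ := h P hP
  have hN : IsNoetherianRing (Localization.AtPrime P) :=
    IsLocalization.isNoetherianRing P.primeCompl _ inferInstance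
  refine isCohenMacaulayLocal_of_mem_nonZeroDivisors (x := algebraMap G _ x) ?_ ?_ ?_
  · rw [IsLocalization.AtPrime.ringKrullDim_eq_height P]
    exact (Ideal.height_le_ringKrullDim_of_ne_top hP.ne_top).trans hdim
  · exact (IsLocalization.AtPrime.to_map_mem_maximal_iff _ P x).2 hxP
  · exact IsLocalization.map_nonZeroDivisors_le P.primeCompl (Localization.AtPrime P)
      (Submonoid.mem_map_of_mem _ hx)

lemma ringKrullDim_le_one_of_surjective {K : Type*} [Field K] (f : K[X] →+* G ⧸ nilradical G)
    (hf : Function.Surjective f) : ringKrullDim G ≤ 1 := by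
  have h1 : ringKrullDim G = ringKrullDim (G ⧸ nilradical G) := by
    rw [ringKrullDim_quotient, PrimeSpectrum.zeroLocus_nilradical]
    exact (Order.krullDim_eq_of_orderIso OrderIso.Set.univ).symm
  rw [h1]
  refine (ringKrullDim_le_of_surjective f hf).trans ?_
  have h2 : Ring.KrullDimLE 1 K[X] := inferInstance
  rw [Ring.krullDimLE_iff] at h2
  exact_mod_cast h2

/-- Localize at `P`, which loses nothing because the complement of `P` consists of nonzerodivisors.
As `T` is not nilpotent, the dimension is not zero and a nonzerodivisor would exist in the maximal
ideal; but some power of it is a multiple of `T` and kills `s`. -/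
lemma not_isCohenMacaulayRing {P : Ideal G} (hP : P.IsMaximal) {T s : G} (hTP : T ∈ P)
    (hrad : P ≤ (Ideal.span {T}).radical) (hs : s ≠ 0) (hTs : T * s = 0)
    (hreg : ∀ t ∉ P, t ∈ nonZeroDivisors G) (hT : ∀ n : ℕ, T ^ n ≠ 0) :
    ¬ IsCohenMacaulayRing G := by
  rintro ⟨_, h⟩
  have hinj : Function.Injective (algebraMap G (Localization.AtPrime P)) :=
    IsLocalization.injective (M := P.primeCompl) _ fun t ht => hreg t ht
  obtain ⟨x, hxP, hx⟩ := exists_mem_nonZeroDivisors_of_isCohenMacaulayLocal (h P) (by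
    intro h0
    have h1 : Ring.KrullDimLE 0 (Localization.AtPrime P) := by
      rw [Ring.krullDimLE_iff, h0]; rfl
    have h2 : algebraMap G (Localization.AtPrime P) T ∈
        IsLocalRing.maximalIdeal (Localization.AtPrime P) :=
      (IsLocalization.AtPrime.to_map_mem_maximal_iff _ P T).2 hTP
    obtain ⟨n, hn⟩ := Ring.KrullDimLE.isNilpotent_iff_mem_maximalIdeal.2 h2
    rw [← map_pow] at hn
    exact hT n (hinj (by rw [hn, map_zero])))
  obtain ⟨⟨p, t⟩, hpt⟩ := IsLocalization.surj P.primeCompl x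
  have hp : p ∈ P := by
    rw [← IsLocalization.AtPrime.to_map_mem_maximal_iff (Localization.AtPrime P) P p, ← hpt]
    exact Ideal.mul_mem_right _ _ hxP
  have hpreg : algebraMap G (Localization.AtPrime P) p ∈
      nonZeroDivisors (Localization.AtPrime P) := by
    rw [← hpt]
    exact mul_mem hx (IsUnit.mem_nonZeroDivisors (IsLocalization.map_units _ t))
  obtain ⟨n, hn⟩ := hrad hp
  obtain ⟨z, hz⟩ := Ideal.mem_span_singleton'.1 hn
  have h0 : algebraMap G (Localization.AtPrime P) s *
      (algebraMap G (Localization.AtPrime P) p) ^ n = 0 := by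
    rw [← map_pow, ← map_mul, ← hz, mul_comm, mul_assoc, hTs, mul_zero, map_zero]
  have h1 := (pow_mem hpreg n).2 _ h0
  exact hs (hinj (by rw [h1, map_zero]))

end CohenMacaulayRing

/-! ### Graded rings generated modulo nilpotents by one initial form. -/

section LocalAssociatedGraded

variable {A : Type*} [CommRing A] [IsLocalRing A]

open IsLocalRing

/-- The projection of `G(𝔪)` onto its component of degree zero. -/
def gradedAugmentation (A : Type*) [CommRing A] [IsLocalRing A] :
    GradedRingOf (maximalIdeal A) →+* ResidueField A :=
  Ideal.Quotient.lift _
    ((residue A).comp ((Polynomial.constantCoeff).comp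
      (reesAlgebra (maximalIdeal A)).val.toRingHom))
    (fun f hf => by
      have h := (toGraded_eq_zero_iff f).1 ((toGraded_eq_zero_iff_mem f).2 hf) 0
      rw [Nat.zero_add, pow_one] at h
      exact (residue_eq_zero_iff _).2 h)

lemma gradedAugmentation_toGraded (f : reesAlgebra (maximalIdeal A)) :
    gradedAugmentation A (toGraded _ f) = residue A ((f : A[X]).coeff 0) :=
  rfl

lemma gradedAugmentation_surjective : Function.Surjective (gradedAugmentation A) := by
  intro x
  obtain ⟨a, rfl⟩ := residue_surjective x
  refine ⟨toGraded _ (algebraMap A _ a), ?_⟩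
  rw [gradedAugmentation_toGraded]
  change residue A ((C a).coeff 0) = _
  rw [coeff_C_zero]

lemma mem_nonZeroDivisors_of_gradedAugmentation_ne_zero
    {z : GradedRingOf (maximalIdeal A)} (hz : gradedAugmentation A z ≠ 0) :
    z ∈ nonZeroDivisors (GradedRingOf (maximalIdeal A)) := by
  obtain ⟨f, rfl⟩ := toGraded_surjective _ z
  exact mem_nonZeroDivisors_of_isUnit_coeff_zero ((residue_ne_zero_iff_isUnit _).1 hz)

lemma gradedAugmentation_initialForm {x : A} (hx : x ∈ maximalIdeal A) :
    gradedAugmentation A (initialForm x hx) = 0 := by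
  rw [initialForm, gradedAugmentation_toGraded]
  simp [reesMonomial, coeff_monomial]

/-- Modulo nilpotents, `G(𝔪)` is generated by the initial form of `x`. -/
def IsGeneratedModNil (x : A) (hx : x ∈ maximalIdeal A) : Prop :=
  ∀ i a (ha : a ∈ maximalIdeal A ^ i), ∃ c : A,
    IsNilpotent (toGraded (maximalIdeal A) (reesMonomial i a ha) -
      toGraded (maximalIdeal A) (algebraMap A _ c) * initialForm x hx ^ i)

/-- The reduced ring is a quotient of a polynomial ring in one variable over the residue field. -/
lemma IsGeneratedModNil.ringKrullDim_le_one {x : A} {hx : x ∈ maximalIdeal A}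
    (h : IsGeneratedModNil x hx) : ringKrullDim (GradedRingOf (maximalIdeal A)) ≤ 1 := by
  let q : GradedRingOf (maximalIdeal A) →+* _ :=
    Ideal.Quotient.mk (nilradical (GradedRingOf (maximalIdeal A)))
  let g : ResidueField A →+* GradedRingOf (maximalIdeal A) :=
    Ideal.Quotient.lift (maximalIdeal A)
      ((toGraded (maximalIdeal A)).comp (algebraMap A (reesAlgebra (maximalIdeal A))))
      (fun a ha => (toGraded_eq_zero_iff_mem _).2 (Ideal.mem_map_of_mem _ ha))
  let F : (ResidueField A)[X] →+* _ := eval₂RingHom (q.comp g) (q (initialForm x hx))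
  refine ringKrullDim_le_one_of_surjective F ?_
  intro z
  obtain ⟨z, rfl⟩ := Ideal.Quotient.mk_surjective z
  obtain ⟨f, rfl⟩ := toGraded_surjective _ z
  rw [← RingHom.mem_range, eq_sum_reesMonomial f, map_sum, map_sum]
  refine sum_mem fun i _ => ?_
  obtain ⟨c, hc⟩ := h i _ (f.2 i)
  refine ⟨C (residue A c) * X ^ (i : ℕ), ?_⟩
  have h1 : F (C (residue A c) * X ^ (i : ℕ)) =
      q (toGraded (maximalIdeal A) (algebraMap A _ c) * initialForm x hx ^ (i : ℕ)) := by
    rw [map_mul, map_pow, map_mul, map_pow]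
    congr 1
    · exact eval₂_C _ _
    · congr 1
      exact eval₂_X _ _
  rw [h1]
  exact (Ideal.Quotient.eq.2 (mem_nilradical.2 hc)).symm

lemma IsGeneratedModNil.ker_le_radical {x : A} {hx : x ∈ maximalIdeal A}
    (h : IsGeneratedModNil x hx) :
    RingHom.ker (gradedAugmentation A) ≤ (Ideal.span {initialForm x hx}).radical := by
  intro z hz
  obtain ⟨f, rfl⟩ := toGraded_surjective _ z
  have hz' : (f : A[X]).coeff 0 ∈ maximalIdeal A := (residue_eq_zero_iff _).1 hz
  rw [eq_sum_reesMonomial f, map_sum]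
  refine sum_mem fun i _ => ?_
  by_cases hi : (i : ℕ) = 0
  · have h0 : toGraded (maximalIdeal A) (reesMonomial (i : ℕ) ((f : A[X]).coeff i) (f.2 i)) = 0 := by
      rw [toGraded_reesMonomial_eq_zero_iff, hi, Nat.zero_add, pow_one]
      exact hz'
    rw [h0]
    exact zero_mem _
  · obtain ⟨c, hc⟩ := h i _ (f.2 i)
    have h1 := Ideal.radical_mono (show ⊥ ≤ Ideal.span {initialForm x hx} from bot_le)
      (mem_nilradical.2 hc)
    have h2 : toGraded (maximalIdeal A) (algebraMap A _ c) * initialForm x hx ^ (i : ℕ) ∈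
        (Ideal.span {initialForm x hx}).radical :=
      Ideal.le_radical (Ideal.mul_mem_left _ _ (Ideal.pow_mem_of_mem _
        (Ideal.mem_span_singleton_self _) _ (by omega)))
    have h3 := add_mem h1 h2
    rwa [sub_add_cancel] at h3

/-- A maximal ideal either is the kernel of the augmentation, which contains the regular initial
form of `x`, or contains an element with nonzero component of degree zero, which is regular. -/
lemma IsGeneratedModNil.isCohenMacaulayRing [IsNoetherianRing A] {x : A} {hx : x ∈ maximalIdeal A}
    (h : IsGeneratedModNil x hx)
    (hreg : ∀ i, ∀ a ∈ maximalIdeal A ^ i, x * a ∈ maximalIdeal A ^ (i + 2) →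
      a ∈ maximalIdeal A ^ (i + 1)) :
    IsCohenMacaulayRing (GradedRingOf (maximalIdeal A)) := by
  refine isCohenMacaulayRing_of_exists_mem_nonZeroDivisors h.ringKrullDim_le_one fun P hP => ?_
  by_cases hle : P ≤ RingHom.ker (gradedAugmentation A)
  · have hmax : (RingHom.ker (gradedAugmentation A)).IsMaximal :=
      RingHom.ker_isMaximal_of_surjective _ gradedAugmentation_surjective
    refine ⟨initialForm x hx, ?_, initialForm_mem_nonZeroDivisors hx hreg⟩
    rw [hP.eq_of_le hmax.ne_top hle]
    exact gradedAugmentation_initialForm hx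
  · obtain ⟨z, hzP, hz⟩ := SetLike.not_le_iff_exists.1 hle
    exact ⟨z, hzP, mem_nonZeroDivisors_of_gradedAugmentation_ne_zero hz⟩

lemma IsGeneratedModNil.not_isCohenMacaulayRing {x : A} {hx : x ∈ maximalIdeal A}
    (h : IsGeneratedModNil x hx) (hpow : ∀ n : ℕ, x ^ n ∉ maximalIdeal A ^ (n + 1))
    {i : ℕ} {a : A} (ha : a ∈ maximalIdeal A ^ i) (ha' : a ∉ maximalIdeal A ^ (i + 1))
    (hxa : x * a ∈ maximalIdeal A ^ (i + 2)) :
    ¬ IsCohenMacaulayRing (GradedRingOf (maximalIdeal A)) := by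
  refine StretchedRing.not_isCohenMacaulayRing
    (RingHom.ker_isMaximal_of_surjective _ gradedAugmentation_surjective)
    (gradedAugmentation_initialForm hx) h.ker_le_radical
    (s := toGraded _ (reesMonomial i a ha)) ?_ ?_ ?_ ?_
  · rwa [ne_eq, toGraded_reesMonomial_eq_zero_iff]
  · rw [initialForm, ← map_mul, reesMonomial_mul, toGraded_reesMonomial_eq_zero_iff]
    rwa [show 1 + i + 1 = i + 2 by ring]
  · exact fun t ht => mem_nonZeroDivisors_of_gradedAugmentation_ne_zero ht
  · intro n
    rw [initialForm_pow, ne_eq, toGraded_reesMonomial_eq_zero_iff]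
    exact hpow n

end LocalAssociatedGraded

/-! ### Cohen-Macaulayness of G(𝔪) for the given family. -/

namespace Bounds

variable {b c e l r : ℕ} {β : ℕ → ℕ} {k : Type*} [Field k]

lemma isGeneratedModNil (hB : Bounds b c e l β r) :
    IsGeneratedModNil (elemE k b e l β) hB.elemE_mem := by
  intro i a ha
  have ha' : a ∈ monIdeal k (semigroupH b e l β) (filt b e l β r i) := by
    rwa [← hB.maximalIdeal_pow]
  suffices h : ∀ ha : a ∈ idealM k b e l β ^ i, ∃ c : RingA k b e l β,
      IsNilpotent (toGraded (idealM k b e l β) (reesMonomial i a ha) -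
        toGraded (idealM k b e l β) (algebraMap _ _ c) *
          initialForm (elemE k b e l β) hB.elemE_mem ^ i) from h ha
  have hle : ∀ {x}, x ∈ monIdeal k (semigroupH b e l β) (filt b e l β r i) →
      x ∈ idealM k b e l β ^ i := fun hx => by rwa [hB.maximalIdeal_pow]
  refine Submodule.span_induction (p := fun a _ => ∀ ha : a ∈ idealM k b e l β ^ i,
    ∃ c : RingA k b e l β, IsNilpotent (toGraded (idealM k b e l β) (reesMonomial i a ha) -
      toGraded (idealM k b e l β) (algebraMap _ _ c) *
        initialForm (elemE k b e l β) hB.elemE_mem ^ i)) ?_ ?_ ?_ ?_ ha'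
  · rintro _ ⟨h, hh, rfl⟩ hm
    obtain ⟨q, n, hn, hqn⟩ := exists_eq_mul_add hB.e_pos (h : ℕ)
    rw [hqn, mem_filt hn] at hh
    by_cases hn0 : n = 0
    · subst hn0
      rw [ordAt_zero_right] at hh
      have hpow : mon k (semigroupH b e l β) h = elemE k b e l β ^ q := by
        rw [elemE, ← mon_nsmul]
        congr 1
        exact Subtype.ext (by rw [hqn, AddSubmonoidClass.coe_nsmul, expE, smul_eq_mul]; rfl)
      by_cases hiq : i = q
      · refine ⟨1, ?_⟩
        rw [initialForm_pow, map_one, map_one, one_mul]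
        simp only [hpow, ← hiq]
        rw [sub_self]
        exact IsNilpotent.zero
      · refine ⟨0, ?_⟩
        have h0 : toGraded (idealM k b e l β) (reesMonomial i _ hm) = 0 := by
          rw [toGraded_reesMonomial_eq_zero_iff, hpow]
          exact Ideal.pow_le_pow_right (by omega) (Ideal.pow_mem_pow hB.elemE_mem q)
        rw [h0, map_zero, map_zero, zero_mul, sub_self]
        exact IsNilpotent.zero
    -- For n ≠ 0 the e-th power of the monomial is the power of uᵉ with exponent q e + n. Since i ≤
    -- q, this exceeds i e, so the class in degree i is nilpotent.
    · refine ⟨0, e, ?_⟩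
      rw [map_zero, map_zero, zero_mul, sub_zero, ← map_pow, reesMonomial_pow,
        toGraded_reesMonomial_eq_zero_iff, ← mon_nsmul, hB.maximalIdeal_pow,
        mon_mem_monIdeal_iff (hB.isSemigroupIdeal_filt _), AddSubmonoidClass.coe_nsmul, hqn,
        smul_eq_mul, show e * (q * e + n) = (q * e + n) * e + 0 by ring,
        mem_filt hB.e_pos, apery_zero, ordAt_zero_right]
      have h1 := hB.ordAt_le (q := q) hn
      have h2 : i ≤ q := by omega
      have h3 : i * e ≤ q * e := Nat.mul_le_mul_right _ h2
      exact ⟨Nat.zero_le _, by exact_mod_cast (by omega : i * e + 1 ≤ q * e + n)⟩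
  · intro hm
    refine ⟨0, ?_⟩
    have h0 : toGraded (idealM k b e l β) (reesMonomial i _ hm) = 0 := by
      rw [toGraded_reesMonomial_eq_zero_iff]
      exact zero_mem _
    rw [h0, map_zero, map_zero, zero_mul, sub_self]
    exact IsNilpotent.zero
  · intro x y hx hy ihx ihy hm
    obtain ⟨c, hc⟩ := ihx (hle hx)
    obtain ⟨d, hd⟩ := ihy (hle hy)
    refine ⟨c + d, ?_⟩
    rw [reesMonomial_add (hle hx) (hle hy), map_add, map_add, map_add, add_mul,
      add_sub_add_comm]
    exact (Commute.all _ _).isNilpotent_add hc hd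
  · intro z x hx ih hm
    obtain ⟨c, hc⟩ := ih (hle hx)
    refine ⟨z * c, ?_⟩
    have h0 : reesMonomial i (z • x) hm =
        algebraMap _ (reesAlgebra (idealM k b e l β)) z * reesMonomial i x (hle hx) := by
      ext1
      exact C_mul_monomial.symm
    rw [h0, map_mul, map_mul, map_mul, mul_assoc, ← mul_sub]
    exact (Commute.all _ _).isNilpotent_mul_left hc

/-- Without jumps, adding e raises the order by exactly one, so the initial form of uᵉ is regular.
-/
lemma isCohenMacaulayRing_of_eq (hB : Bounds b c e l β r) (hr : r = l) :
    IsCohenMacaulayRing (GradedRingOf (idealM k b e l β)) := by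
  have := isNoetherianRing_ringA k b e l β
  refine hB.isGeneratedModNil.isCohenMacaulayRing fun i a ha hea => ?_
  change a ∈ idealM k b e l β ^ (i + 1)
  rw [hB.maximalIdeal_pow, mem_monIdeal_iff (hB.isSemigroupIdeal_filt _)] at ha hea ⊢
  intro h hh
  have h1 := hea (h + e)
  rw [map_mul, elemE, expand_mon, mul_comm] at h1
  change _ → PowerSeries.coeff (h + e) (_ * PowerSeries.X ^ e) = 0 at h1
  rw [PowerSeries.coeff_mul_X_pow] at h1
  by_cases hi : h ∈ filt b e l β r i
  · refine h1 fun h2 => hh ?_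
    obtain ⟨q, n, hn, rfl⟩ := exists_eq_mul_add hB.e_pos h
    rw [show q * e + n + e = (q + 1) * e + n by ring, mem_filt hn] at h2
    rw [mem_filt hn] at hi ⊢
    refine ⟨hi.1, ?_⟩
    unfold ordAt at *
    split_ifs at * <;> omega
  · exact ha h hi

/-- If r > ℓ, the monomial just before the jump at n = r, with q = b r - 1, has order b r - b_r, and
its product with uᵉ has order r ≥ b r - b_r + 2. Its class is thus a nonzero element killed by the
initial form of uᵉ. -/
lemma eq_of_isCohenMacaulayRing (hB : Bounds b c e l β r)
    (hG : IsCohenMacaulayRing (GradedRingOf (idealM k b e l β))) : r = l := by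
  by_contra hne
  have hlr := hB.l_le_r
  have hre := hB.r_lt
  have hup := hB.upper r (by omega) hre
  have hla := hB.large r (by omega) le_rfl
  have hap : apery b l β r = β r := by rw [apery, if_neg (by omega)]
  have hord : ordAt b l β r (b * r - 1) r = ((b * r - β r : ℕ) : ℤ) := by
    rw [ordAt, if_neg (by omega)]
    omega
  have hH : (b * r - 1) * e + r ∈ semigroupH b e l β :=
    (hB.mem_semigroupH_iff hre).2 (by omega)
  refine hB.isGeneratedModNil.not_isCohenMacaulayRing ?_ (i := b * r - β r)
    (a := mon k (semigroupH b e l β) ⟨_, hH⟩) ?_ ?_ ?_ hG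
  · intro n
    change _ ∉ idealM k b e l β ^ (n + 1)
    rw [elemE, ← mon_nsmul, hB.maximalIdeal_pow,
      mon_mem_monIdeal_iff (hB.isSemigroupIdeal_filt _), AddSubmonoidClass.coe_nsmul]
    change n • e ∉ _
    rw [smul_eq_mul, ← Nat.add_zero (n * e), mem_filt hB.e_pos, ordAt_zero_right]
    push_cast
    omega
  · change _ ∈ idealM k b e l β ^ _
    rw [hB.maximalIdeal_pow, mon_mem_monIdeal_iff (hB.isSemigroupIdeal_filt _), mem_filt hre]
    exact ⟨by omega, by omega⟩
  · change _ ∉ idealM k b e l β ^ _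
    rw [hB.maximalIdeal_pow, mon_mem_monIdeal_iff (hB.isSemigroupIdeal_filt _), mem_filt hre]
    omega
  · change _ ∈ idealM k b e l β ^ _
    rw [elemE, ← mon_add, hB.maximalIdeal_pow, mon_mem_monIdeal_iff (hB.isSemigroupIdeal_filt _)]
    change e + ((b * r - 1) * e + r) ∈ _
    rw [show e + ((b * r - 1) * e + r) = (b * r - 1 + 1) * e + r by ring,
      Nat.sub_add_cancel (by omega), mem_filt hre, ordAt, if_pos (by omega)]
    omega

lemma isCohenMacaulayRing_iff (hB : Bounds b c e l β r) :
    IsCohenMacaulayRing (AssociatedGradedRing (idealM k b e l β)) ↔ r = l :=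
  ⟨hB.eq_of_isCohenMacaulayRing, hB.isCohenMacaulayRing_of_eq⟩

end Bounds

end StretchedRing

end

theorem theorem6p6 (k : Type*) [Field k] :
    (∀ (b e l : ℕ) (β : ℕ → ℕ) (r : ℕ),
      StretchedRing.Admissible b e l β → StretchedRing.IsR b e l β r →
      -- the ring `A`
      (StretchedRing.IsCohenMacaulayLocal (StretchedRing.RingA k b e l β) ∧
        ringKrullDim (StretchedRing.RingA k b e l β) = 1 ∧
        StretchedRing.IsStretched (StretchedRing.idealQ k b e l β)
          (StretchedRing.idealM k b e l β) ∧
        StretchedRing.cmType (StretchedRing.idealQ k b e l β) = ((e - l : ℕ) : ℕ∞) ∧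
        (StretchedRing.idealM k b e l β).spanFinrank = e - l + 1) ∧
      -- index of nilpotency and reduction number
      (StretchedRing.IsNilpotencyIndex (StretchedRing.idealQ k b e l β)
          (StretchedRing.idealM k b e l β) l ∧
        StretchedRing.IsReductionNumber (StretchedRing.idealQ k b e l β)
          (StretchedRing.idealM k b e l β) r) ∧
      -- the set `Λ`
      ((fun n : ℕ => (n : ℤ)) '' StretchedRing.Lam (StretchedRing.idealQ k b e l β)
          (StretchedRing.idealM k b e l β) =
        (fun n : ℕ => (b : ℤ) * n - β n + 1) '' Set.Icc (l + 1) r) ∧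
      -- the Hilbert-Samuel function
      (∀ n : ℕ, r - 1 ≤ n → ∃ N : ℕ,
        Module.length (StretchedRing.RingA k b e l β)
          (StretchedRing.RingA k b e l β ⧸ StretchedRing.idealM k b e l β ^ (n + 1)) = (N : ℕ∞) ∧
        (N : ℤ) = (e : ℤ) * (n + 1) - ((e : ℤ) - 1 + (l.choose 2 : ℤ) +
          ∑ m ∈ Finset.Icc (l + 1) r, ((β m : ℤ) - b * m + m - 1))) ∧
      -- Cohen-Macaulayness of the associated graded ring
      ((StretchedRing.IsCohenMacaulayRing
          (StretchedRing.AssociatedGradedRing (StretchedRing.idealM k b e l β)) ↔ r = l) ∧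
        (l + 1 < e → (r = l ↔ (β (l + 1) : ℤ) ≤ (b : ℤ) * l + b - l)))) ∧
    -- the reduction number can exceed the index of nilpotency by any amount
    (∀ l N : ℕ, 2 ≤ l → ∃ (b e : ℕ) (β : ℕ → ℕ), StretchedRing.Admissible b e l β ∧
      StretchedRing.IsNilpotencyIndex (StretchedRing.idealQ k b e l β)
        (StretchedRing.idealM k b e l β) l ∧
      StretchedRing.IsReductionNumber (StretchedRing.idealQ k b e l β)
        (StretchedRing.idealM k b e l β) (l + N)) := by
  refine ⟨fun b e l β r hA hr => ?_, fun l N hl => ?_⟩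
  · have hB := hA.bounds hr
    refine ⟨⟨hB.isCohenMacaulayLocal_ringA, hB.ringKrullDim_ringA, hB.isStretched, hB.cmType_eq,
      hB.spanFinrank_eq⟩, ⟨hB.isNilpotencyIndex, hB.isReductionNumber⟩, hB.image_Lam,
      fun n hn => ⟨_, hB.length_quotient_pow hn, hB.sum_gap hn⟩, hB.isCohenMacaulayRing_iff,
      hB.eq_iff_first_le⟩
  · obtain ⟨hA, hr⟩ := StretchedRing.admissible_example hl N
    exact ⟨2, l + N + 1, fun n => n + l, hA, (hA.bounds hr).isNilpotencyIndex,
      (hA.bounds hr).isReductionNumber⟩
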